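/- Let $X=\mathbb H^2/\Gamma$ be a closed oriented hyperbolic surface ($\Gamma$ a torsion-free cocompact Fuchsian group), let $\mathcal G$ be the space of unoriented geodesics of $\mathbb H^2$, identified with unordered pairs of distinct points of $\partial\mathbb H^2$, and let $\mu$ be a geodesic current on $X$, that is, a $\Gamma$-invariant locally finite positive Radon measure on $\mathcal G$. For $x,y\in\mathbb H^2$ put $$d_\mu(x,y)=\tfrac12\bigl(\mu(G[x,y))+\mu(G(x,y])\bigr),$$ where $G(\tau)$ denotes the set of geodesics meeting the (half-open) segment $\tau$ in exactly one point, and let $X_\mu$ be the dual space of $\mu$, the metric space obtained from the pseudo-metric space $(\mathbb H^2,d_\mu)$ by identifying points at distance $0$. A box is a set $B=I_{a,b}\times I_{c,d}$ of geodesics with one endpoint in $I_{a,b}$ and the other in $I_{c,d}$; its opposite box is $B^\perp=I_{d,a}\times I_{b,c}$. Here $I_{a,b},I_{b,c},I_{c,d},I_{d,a}$ are non-empty (open, half-open or closed, possibly degenerate) counter-clockwise intervals of $\partial\mathbb H^2$ with the indicated endpoints, which partition $\partial\mathbb H^2$. Let $$\delta_\mu=\sup_{B}\min\{\mu(B),\mu(B^\perp)\},$$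 the supremum being over all boxes. Then $\delta_\mu<\infty$, and $X_\mu$ is $\delta_\mu$-hyperbolic in the sense of the Gromov four-point condition: for any four points $x,y,z,w\in X_\mu$, the two largest of $d(x,y)+d(z,w)$, $d(x,z)+d(y,w)$, $d(y,z)+d(x,w)$ differ by at most $2\delta_\mu$. Moreover $\delta_\mu$ is optimal: it is the smallest real number $\delta$ for which $X_\mu$ satisfies the four-point condition with constant $\delta$. -/

import Mathlib

open Set MeasureTheory
open scoped UpperHalfPlane MatrixGroups ENNReal

namespace GeodesicCurrents

/-! ### The boundary at infinity and the space of geodesics of the hyperbolic plane -/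

/-- The boundary at infinity of the upper half-plane `ℍ`: the circle `ℝ ∪ {∞}`. -/
abbrev Boundary : Type := OnePoint ℝ

/-- The action of `SL(2, ℝ)` on the boundary at infinity by Möbius transformations. -/
noncomputable def bdAct (g : SL(2, ℝ)) (ξ : Boundary) : Boundary :=
  (g : GL (Fin 2) ℝ) • ξ

/-- Ordered pairs of distinct points at infinity. -/
abbrev DistinctPair : Type := {p : Boundary × Boundary // p.1 ≠ p.2}

/-- The equivalence relation `(ξ, η) ∼ (η, ξ)`. -/
instance flipSetoid : Setoid DistinctPair where
  r p q := p.1 = q.1 ∨ p.1 = q.1.swap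
  iseqv :=
    { refl := fun _ => Or.inl rfl
      symm := by
        rintro p q (h | h)
        · exact Or.inl h.symm
        · exact Or.inr (by rw [h, Prod.swap_swap])
      trans := by
        rintro p q r (h | h) (h' | h')
        · exact Or.inl (h.trans h')
        · exact Or.inr (h.trans h')
        · exact Or.inr (by rw [h, h'])
        · exact Or.inl (by rw [h, h', Prod.swap_swap]) }

/-- The space of unoriented bi-infinite geodesics of `ℍ`, a geodesic being identified with the
unordered pair of its distinct endpoints; it carries the quotient topology. -/
def Geodesic : Type := Quotient flipSetoid

instance : TopologicalSpace Geodesic := inferInstanceAs (TopologicalSpace (Quotient flipSetoid))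

instance : MeasurableSpace Geodesic := borel Geodesic

instance : BorelSpace Geodesic := ⟨rfl⟩

/-- The geodesic with given endpoints. -/
def Geodesic.mk (ξ η : Boundary) (h : ξ ≠ η) : Geodesic := Quotient.mk flipSetoid ⟨(ξ, η), h⟩

/-- The action of `SL(2, ℝ)` on the space of geodesics, through the endpoints. -/
noncomputable def Geodesic.act (g : SL(2, ℝ)) : Geodesic → Geodesic :=
  Quotient.map
    (fun p : DistinctPair => (⟨(bdAct g p.1.1, bdAct g p.1.2),
      fun h => p.2 (MulAction.injective (g : GL (Fin 2) ℝ) h)⟩ : DistinctPair))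
    (by
      rintro ⟨⟨a, b⟩, hp⟩ ⟨⟨c, d⟩, hq⟩ (h | h)
      · exact Or.inl (by simp_all)
      · exact Or.inr (by simp_all))

/-- An equation of the geodesic of `ℍ` with endpoints `ξ ≠ η`: for real endpoints `a, b` it is the
half-circle `(x - a) (x - b) + y ^ 2 = 0`, for the endpoints `a, ∞` the vertical line `x = a`. -/
noncomputable def lineEq (ξ η : Boundary) (z : ℍ) : ℝ :=
  ξ.elim (η.elim 1 (fun b => z.re - b))
    (fun a => η.elim (z.re - a) (fun b => (z.re - a) * (z.re - b) + z.im ^ 2))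

theorem lineEq_comm (ξ η : Boundary) (z : ℍ) : lineEq ξ η z = lineEq η ξ z := by
  induction ξ using OnePoint.rec <;> induction η using OnePoint.rec <;> simp [lineEq, mul_comm]

/-- The set of points of `ℍ` on a geodesic. -/
noncomputable def Geodesic.points : Geodesic → Set ℍ :=
  Quotient.lift (fun p : DistinctPair => {z : ℍ | lineEq p.1.1 p.1.2 z = 0})
    (by
      rintro ⟨⟨a, b⟩, hp⟩ ⟨⟨c, d⟩, hq⟩ (h | h)
      · simp_all
      · obtain ⟨rfl, rfl⟩ : a = d ∧ b = c := by simpa using h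
        ext z
        simp [lineEq_comm a b z])

/-! ### Closed hyperbolic surfaces and geodesic currents -/

/-- `Γ` acts on `ℍ` as the deck transformation group of a closed (connected, oriented) hyperbolic
surface `X = ℍ / Γ`: properly discontinuously, freely and with compact quotient. As `-1` acts
trivially on `ℍ`, freeness is required only up to elements acting as the identity, so `Γ` may be
the full preimage in `SL(2, ℝ)` of any torsion-free cocompact Fuchsian group in `PSL(2, ℝ)`. -/
structure IsClosedSurfaceGroup (Γ : Subgroup SL(2, ℝ)) : Prop where
  properlyDiscontinuous : ProperlyDiscontinuousSMul Γ ℍ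
  free : ∀ g ∈ Γ, ∀ z : ℍ, g • z = z → ∀ w : ℍ, g • w = w
  compact : CompactSpace (MulAction.orbitRel.Quotient Γ ℍ)

/-- A geodesic current: a `Γ`-invariant locally finite positive Radon measure on the space of
unoriented geodesics. -/
structure GeodesicCurrent (Γ : Subgroup SL(2, ℝ)) where
  measure : Measure Geodesic
  locallyFinite : IsLocallyFiniteMeasure measure
  regular : measure.Regular
  invariant : ∀ g ∈ Γ, ∀ A : Set Geodesic, MeasurableSet A →
    measure (Geodesic.act g ⁻¹' A) = measure A

/-! ### Boxes of geodesics -/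

/-- The circle `ℝ ∪ {∞}` cut open at `∞`, which becomes the largest point. -/
noncomputable def cut (ξ : Boundary) : EReal := ξ.elim ⊤ (fun a => (a : EReal))

/-- The open interval `(a, b)` of the boundary circle, from `a` to `b` in the counter-clockwise
sense, that is, in the sense of increasing real numbers; it is empty for `a = b`. -/
def openArc (a b : Boundary) : Set Boundary :=
  {t | (cut a < cut t ∧ cut t < cut b) ∨ (cut t < cut b ∧ cut b < cut a) ∨
    (cut b < cut a ∧ cut a < cut t)}

/-- `I` is a generalized ordered interval from `a` to `b`: non-empty, and one of `(a, b)`, `[a, b)`,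
`(a, b]`, `[a, b]` (the singleton `{a}` if `a = b`). -/
def IsArc (a b : Boundary) (I : Set Boundary) : Prop :=
  I.Nonempty ∧ (I = openArc a b ∨ I = insert a (openArc a b) ∨ I = insert b (openArc a b) ∨
    I = insert a (insert b (openArc a b)))

/-- The data of a box `I_{a,b} × I_{c,d}` with its opposite box `I_{d,a} × I_{b,c}`: points
`a, b, c, d` (the vertices `0, 1, 2, 3`) and intervals `I_{a,b}, I_{b,c}, I_{c,d}, I_{d,a}`
(the sides `0, 1, 2, 3`) which partition the boundary circle. -/
structure Box where
  vertex : Fin 4 → Boundary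
  side : Fin 4 → Set Boundary
  isArc : ∀ i, IsArc (vertex i) (vertex (i + 1)) (side i)
  partition : ∀ t, ∃! i, t ∈ side i

/-- The set of geodesics with one endpoint in `I` and the other one in `J`. -/
def geodesicsBetween (I J : Set Boundary) : Set Geodesic :=
  {γ | ∃ ξ ∈ I, ∃ η ∈ J, ∃ h : ξ ≠ η, γ = Geodesic.mk ξ η h}

/-- The geodesics of the box, `I_{a,b} × I_{c,d}`. -/
def Box.carrier (B : Box) : Set Geodesic := geodesicsBetween (B.side 0) (B.side 2)

/-- The opposite box, whose geodesics are `I_{d,a} × I_{b,c}`. -/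
def Box.opposite (B : Box) : Box where
  vertex i := B.vertex (i + 3)
  side i := B.side (i + 3)
  isArc i := by
    have h := B.isArc (i + 3)
    rwa [add_right_comm i 3 1] at h
  partition t := by
    obtain ⟨i, hi, hu⟩ := B.partition t
    refine ⟨i - 3, by simpa using hi, fun j hj => ?_⟩
    rw [← hu (j + 3) hj, add_sub_cancel_right]

/-- The constant `δ_μ = sup_B min (μ B) (μ B^⊥)`. -/
noncomputable def hypConst {Γ : Subgroup SL(2, ℝ)} (μ : GeodesicCurrent Γ) : ℝ≥0∞ :=
  ⨆ B : Box, min (μ.measure B.carrier) (μ.measure B.opposite.carrier)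

/-! ### Transversals and the pseudo-distance of a current -/

/-- The geodesic segment `[x, y]` of `ℍ`. -/
def seg (x y : ℍ) : Set ℍ := {z | dist x z + dist z y = dist x y}

/-- The set `G(τ)` of geodesics intersecting the (possibly half-open) segment `τ` transversely, that
is, in exactly one point. -/
def transversal (τ : Set ℍ) : Set Geodesic := {γ | ∃ p, γ.points ∩ τ = {p}}

/-- `d_μ(x, y) = (μ(G[x, y)) + μ(G(x, y])) / 2`, as an extended non-negative real number. -/
noncomputable def edistCurrent (m : Measure Geodesic) (x y : ℍ) : ℝ≥0∞ :=
  (m (transversal (seg x y \ {y})) + m (transversal (seg x y \ {x}))) / 2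


/-- In the coordinates `(re z, |z| ^ 2)` geodesics are straight: `z` lies on the geodesic segment
`[x, y]` iff it lies on the straight segment in these coordinates. -/
theorem mem_seg_iff (x y z : ℍ) : z ∈ seg x y ↔ ∃ t : ℝ, 0 ≤ t ∧ t ≤ 1 ∧
    z.re = (1 - t) * x.re + t * y.re ∧
    z.re ^ 2 + z.im ^ 2 = (1 - t) * (x.re ^ 2 + x.im ^ 2) + t * (y.re ^ 2 + y.im ^ 2) := by
  have hC : ∀ a b : ℍ, Real.cosh (dist a b) * (a.im * b.im) =
      (a.re ^ 2 + a.im ^ 2 + (b.re ^ 2 + b.im ^ 2) - 2 * a.re * b.re) / 2 := by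
    intro a b
    have ha := a.im_pos
    have hb := b.im_pos
    rw [UpperHalfPlane.cosh_dist, Complex.dist_eq, Complex.sq_norm, Complex.normSq_apply]
    simp only [Complex.sub_re, Complex.sub_im, UpperHalfPlane.coe_re, UpperHalfPlane.coe_im]
    field_simp
    ring
  have key : z ∈ seg x y ↔
      Real.cosh (dist x y) = Real.cosh (dist x z + dist z y) := by
    constructor
    · intro h
      rw [show dist x z + dist z y = dist x y from h]
    · intro h
      have := Real.cosh_injOn (show dist x y ∈ Ici 0 from dist_nonneg)
        (show dist x z + dist z y ∈ Ici 0 from add_nonneg dist_nonneg dist_nonneg) h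
      exact this.symm
  by_cases hne : x = y
  · subst hne
    constructor
    · intro h
      have h' : dist x z + dist z x = dist x x := h
      rw [dist_self, dist_comm z x] at h'
      have : x = z := dist_eq_zero.1 (by linarith [dist_nonneg (x := x) (y := z)])
      subst this
      exact ⟨0, le_rfl, zero_le_one, by ring, by ring⟩
    · rintro ⟨t, -, -, h1, h2⟩
      have hr : z.re = x.re := by rw [h1]; ring
      have hi : z.im = x.im := by
        have : z.im ^ 2 = x.im ^ 2 := by rw [hr] at h2; linarith
        exact (pow_left_inj₀ z.im_pos.le x.im_pos.le two_ne_zero).1 this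
      rw [UpperHalfPlane.ext_re_im hr hi]
      simp [seg]
  have h1 := hC x z
  have h2 := hC z y
  have h3 := hC x y
  have hs1 := Real.cosh_sq (dist x z)
  have hs2 := Real.cosh_sq (dist z y)
  have hp1 : 0 ≤ Real.sinh (dist x z) := Real.sinh_nonneg_iff.2 dist_nonneg
  have hp2 : 0 ≤ Real.sinh (dist z y) := Real.sinh_nonneg_iff.2 dist_nonneg
  have hx := x.im_pos
  have hy := y.im_pos
  have hz := z.im_pos
  have hxy : ¬ (x.re = y.re ∧ x.im = y.im) := fun h =>
    hne (UpperHalfPlane.ext_re_im h.1 h.2)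
  rw [key, Real.cosh_add]
  clear key hC hne
  generalize Real.cosh (dist x z) = c1 at *
  generalize Real.cosh (dist z y) = c2 at *
  generalize Real.cosh (dist x y) = c3 at *
  generalize Real.sinh (dist x z) = s1 at *
  generalize Real.sinh (dist z y) = s2 at *
  generalize x.im = a at *
  generalize y.im = b at *
  generalize z.im = h at *
  generalize x.re = u at *
  generalize y.re = v at *
  generalize z.re = w at *
  have hd : (c3 - c1 * c2) ^ 2 * (a ^ 2 * b ^ 2 * h ^ 4) =
      s1 ^ 2 * s2 ^ 2 * (a ^ 2 * b ^ 2 * h ^ 4) - h ^ 2 / 4 *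
      ((w - u) * (v ^ 2 + b ^ 2 - u ^ 2 - a ^ 2) -
        (v - u) * (w ^ 2 + h ^ 2 - u ^ 2 - a ^ 2)) ^ 2 := by
    have e1 : s1 ^ 2 = c1 ^ 2 - 1 := by linarith
    have e2 : s2 ^ 2 = c2 ^ 2 - 1 := by linarith
    have e : (c3 - c1 * c2) * (a * b * h ^ 2) = c3 * (a * b) * h ^ 2 -
      (c1 * (a * h)) * (c2 * (h * b)) := by ring
    have e' : (c3 - c1 * c2) ^ 2 * (a ^ 2 * b ^ 2 * h ^ 4) =
      ((c3 - c1 * c2) * (a * b * h ^ 2)) ^ 2 := by ring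
    have e'' : s1 ^ 2 * s2 ^ 2 * (a ^ 2 * b ^ 2 * h ^ 4) =
      ((c1 * (a * h)) ^ 2 - a ^ 2 * h ^ 2) * ((c2 * (h * b)) ^ 2 - h ^ 2 * b ^ 2) := by
      rw [e1, e2]; ring
    rw [e', e'', e, h1, h2, h3]
    ring
  have hN : ∀ t : ℝ, w = (1 - t) * u + t * v →
      w ^ 2 + h ^ 2 = (1 - t) * (u ^ 2 + a ^ 2) + t * (v ^ 2 + b ^ 2) →
      (c3 - c1 * c2) * (a * b * h ^ 2) = t * (1 - t) *
        (((u ^ 2 + a ^ 2 + (v ^ 2 + b ^ 2) - 2 * u * v) / 2) ^ 2 - a ^ 2 * b ^ 2) := by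
    intro t hw hq
    have e : (c3 - c1 * c2) * (a * b * h ^ 2) = c3 * (a * b) * h ^ 2 -
      (c1 * (a * h)) * (c2 * (h * b)) := by ring
    have hh : h ^ 2 = (1 - t) * (u ^ 2 + a ^ 2) + t * (v ^ 2 + b ^ 2) - w ^ 2 := by linarith
    rw [e, h1, h2, h3, hq, hh, hw]
    ring
  have hpos : 0 < ((u ^ 2 + a ^ 2 + (v ^ 2 + b ^ 2) - 2 * u * v) / 2) ^ 2 - a ^ 2 * b ^ 2 := by
    have e : ((u ^ 2 + a ^ 2 + (v ^ 2 + b ^ 2) - 2 * u * v) / 2) ^ 2 - a ^ 2 * b ^ 2 =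
      (((u - v) ^ 2 + (a - b) ^ 2) / 2) * (((u - v) ^ 2 + (a + b) ^ 2) / 2) := by ring
    rw [e]
    have : 0 < (u - v) ^ 2 + (a - b) ^ 2 := by
      by_contra hcon
      have hcon' := not_lt.1 hcon
      have i1 : (u - v) ^ 2 = 0 :=
        le_antisymm ((le_add_of_nonneg_right (sq_nonneg _)).trans hcon') (sq_nonneg _)
      have i2 : (a - b) ^ 2 = 0 :=
        le_antisymm ((le_add_of_nonneg_left (sq_nonneg _)).trans hcon') (sq_nonneg _)
      exact hxy ⟨sub_eq_zero.1 (pow_eq_zero_iff two_ne_zero |>.1 i1),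
        sub_eq_zero.1 (pow_eq_zero_iff two_ne_zero |>.1 i2)⟩
    positivity
  have hP : 0 < a ^ 2 * b ^ 2 * h ^ 4 := by positivity
  have hP' : 0 < a * b * h ^ 2 := by positivity
  constructor
  · intro hc
    have hdet : (w - u) * (v ^ 2 + b ^ 2 - u ^ 2 - a ^ 2) -
        (v - u) * (w ^ 2 + h ^ 2 - u ^ 2 - a ^ 2) = 0 := by
      have e : (c3 - c1 * c2) = s1 * s2 := by linarith
      rw [e] at hd
      have : h ^ 2 / 4 * ((w - u) * (v ^ 2 + b ^ 2 - u ^ 2 - a ^ 2) -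
        (v - u) * (w ^ 2 + h ^ 2 - u ^ 2 - a ^ 2)) ^ 2 = 0 := by linarith
      have h4 : h ^ 2 / 4 ≠ 0 := by positivity
      exact pow_eq_zero_iff two_ne_zero |>.1 ((mul_eq_zero.1 this).resolve_left h4)
    obtain ⟨t, ht1, ht2⟩ : ∃ t : ℝ, w = (1 - t) * u + t * v ∧
        w ^ 2 + h ^ 2 = (1 - t) * (u ^ 2 + a ^ 2) + t * (v ^ 2 + b ^ 2) := by
      by_cases huv : v - u = 0
      · have hvu : v = u := by linarith
        have hq : v ^ 2 + b ^ 2 - u ^ 2 - a ^ 2 ≠ 0 := by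
          intro h0
          refine hxy ⟨hvu.symm, ?_⟩
          have : a ^ 2 = b ^ 2 := by rw [hvu] at h0; linarith
          exact (pow_left_inj₀ hx.le hy.le two_ne_zero).1 this
        rw [huv, zero_mul, sub_zero] at hdet
        have hw := (mul_eq_zero.1 hdet).resolve_right hq
        refine ⟨(w ^ 2 + h ^ 2 - u ^ 2 - a ^ 2) / (v ^ 2 + b ^ 2 - u ^ 2 - a ^ 2), ?_, ?_⟩
        · rw [hvu]; linarith
        · have := div_mul_cancel₀ (w ^ 2 + h ^ 2 - u ^ 2 - a ^ 2) hq
          linear_combination -this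
      · refine ⟨(w - u) / (v - u), ?_, ?_⟩
        · have := div_mul_cancel₀ (w - u) huv
          linear_combination -this
        · have := div_mul_cancel₀ (w - u) huv
          have h5 : (v - u) * ((w ^ 2 + h ^ 2 - u ^ 2 - a ^ 2) -
              (w - u) / (v - u) * (v ^ 2 + b ^ 2 - u ^ 2 - a ^ 2)) = 0 := by
            linear_combination (-(v ^ 2 + b ^ 2 - u ^ 2 - a ^ 2)) * this - hdet
          have h6 := (mul_eq_zero.1 h5).resolve_left huv
          linear_combination h6
    have hn := hN t ht1 ht2
    have hge : 0 ≤ t * (1 - t) := by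
      have : 0 ≤ (c3 - c1 * c2) * (a * b * h ^ 2) := by
        rw [show c3 - c1 * c2 = s1 * s2 by linarith]
        positivity
      rw [hn] at this
      exact nonneg_of_mul_nonneg_left this hpos
    refine ⟨t, ?_, ?_, ht1, ht2⟩
    · by_contra hcon
      have hcon' := not_le.1 hcon
      exact absurd hge (not_le.2 (mul_neg_of_neg_of_pos hcon' (by linarith)))
    · by_contra hcon
      have hcon' := not_le.1 hcon
      exact absurd hge (not_le.2 (mul_neg_of_pos_of_neg (by linarith) (by linarith)))
  · rintro ⟨t, h0, h1', ht1, ht2⟩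
    have hn := hN t ht1 ht2
    have hdet : (w - u) * (v ^ 2 + b ^ 2 - u ^ 2 - a ^ 2) -
        (v - u) * (w ^ 2 + h ^ 2 - u ^ 2 - a ^ 2) = 0 := by
      rw [ht2, ht1]; ring
    rw [hdet] at hd
    have hge : 0 ≤ c3 - c1 * c2 := by
      refine nonneg_of_mul_nonneg_left (b := a * b * h ^ 2) ?_ hP'
      rw [hn]
      have : 0 ≤ 1 - t := by linarith
      positivity
    have hsq : (c3 - c1 * c2) ^ 2 = (s1 * s2) ^ 2 := by
      refine mul_right_cancel₀ hP.ne' ?_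
      rw [hd]; ring
    have := (pow_left_inj₀ hge (mul_nonneg hp1 hp2) two_ne_zero).1 hsq
    linarith

/-- The point of `ℍ` dividing the segment `[x, y]` in a given ratio of the coordinates
`(re z, |z| ^ 2)`. -/
theorem exists_point (x y : ℍ) (t : ℝ) (h0 : 0 ≤ t) (h1 : t ≤ 1) : ∃ z : ℍ,
    z.re = (1 - t) * x.re + t * y.re ∧
    z.re ^ 2 + z.im ^ 2 = (1 - t) * (x.re ^ 2 + x.im ^ 2) + t * (y.re ^ 2 + y.im ^ 2) := by
  have hp : 0 < (1 - t) * x.im ^ 2 + t * y.im ^ 2 + t * (1 - t) * (x.re - y.re) ^ 2 := by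
    have hx := x.im_pos
    have hy := y.im_pos
    have h1' : 0 ≤ 1 - t := by linarith
    have h2 : 0 < (1 - t) * x.im ^ 2 + t * y.im ^ 2 := by
      rcases h0.eq_or_lt with rfl | h
      · have h2 : 0 < x.im ^ 2 := pow_pos hx 2
        rwa [sub_zero, one_mul, zero_mul, add_zero]
      · have h2 : 0 < t * y.im ^ 2 := mul_pos h (pow_pos hy 2)
        have h3 : 0 ≤ (1 - t) * x.im ^ 2 := mul_nonneg h1' (sq_nonneg _)
        linarith
    exact add_pos_of_pos_of_nonneg h2 (mul_nonneg (mul_nonneg h0 h1') (sq_nonneg _))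
  refine ⟨⟨⟨(1 - t) * x.re + t * y.re, √((1 - t) * x.im ^ 2 + t * y.im ^ 2 +
    t * (1 - t) * (x.re - y.re) ^ 2)⟩, Real.sqrt_pos.2 hp⟩, rfl, ?_⟩
  change ((1 - t) * x.re + t * y.re) ^ 2 + √((1 - t) * x.im ^ 2 + t * y.im ^ 2 +
    t * (1 - t) * (x.re - y.re) ^ 2) ^ 2 = _
  rw [Real.sq_sqrt hp.le]
  ring

theorem ext_coord {z w : ℍ} (h1 : z.re = w.re)
    (h2 : z.re ^ 2 + z.im ^ 2 = w.re ^ 2 + w.im ^ 2) : z = w := by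
  refine UpperHalfPlane.ext_re_im h1 ?_
  rw [h1] at h2
  exact (pow_left_inj₀ z.im_pos.le w.im_pos.le two_ne_zero).1 (by linarith)

theorem lineEq_affine (ξ η : Boundary) (h : ξ ≠ η) (x y z : ℍ) (t : ℝ)
    (h1 : z.re = (1 - t) * x.re + t * y.re)
    (h2 : z.re ^ 2 + z.im ^ 2 =
      (1 - t) * (x.re ^ 2 + x.im ^ 2) + t * (y.re ^ 2 + y.im ^ 2)) :
    lineEq ξ η z = (1 - t) * lineEq ξ η x + t * lineEq ξ η y := by
  induction ξ using OnePoint.rec with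
  | infty =>
    induction η using OnePoint.rec with
    | infty => exact absurd rfl h
    | coe b => simp only [lineEq, OnePoint.elim_some, OnePoint.elim_infty]; linear_combination h1
  | coe a =>
    induction η using OnePoint.rec with
    | infty => simp only [lineEq, OnePoint.elim_some, OnePoint.elim_infty]; linear_combination h1
    | coe b =>
      simp only [lineEq, OnePoint.elim_some]
      linear_combination h2 - (a + b) * h1

theorem mem_points (ξ η : Boundary) (h : ξ ≠ η) (z : ℍ) :
    z ∈ (Geodesic.mk ξ η h).points ↔ lineEq ξ η z = 0 := Iff.rfl

/-- A geodesic meets the segment `[x, y)` transversely iff its equation takes values of opposite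
signs at `x` and `y`, or vanishes at `x` but not at `y`. -/
theorem mem_transversal_iff (ξ η : Boundary) (h : ξ ≠ η) (x y : ℍ) :
    Geodesic.mk ξ η h ∈ transversal (seg x y \ {y}) ↔
      lineEq ξ η x * lineEq ξ η y < 0 ∨ (lineEq ξ η x = 0 ∧ lineEq ξ η y ≠ 0) := by
  have haff := lineEq_affine ξ η h x y
  have hseg := mem_seg_iff x y
  by_cases hxy : x = y
  · subst hxy
    constructor
    · rintro ⟨p, hp⟩
      obtain ⟨-, hp1, hp2⟩ : p ∈ (Geodesic.mk ξ η h).points ∩ (seg x x \ {x}) := by rw [hp]; rfl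
      obtain ⟨t, -, -, h1, h2⟩ := (hseg p).1 hp1
      exact absurd (ext_coord (by rw [h1]; ring) (by rw [h2]; ring)) hp2
    · rintro (h' | ⟨h1, h2⟩)
      · exact absurd h' (not_lt.2 (mul_self_nonneg _))
      · exact absurd h1 h2
  constructor
  · rintro ⟨p, hp⟩
    obtain ⟨hp0, hp1, hp2⟩ : p ∈ (Geodesic.mk ξ η h).points ∩ (seg x y \ {y}) := by rw [hp]; rfl
    obtain ⟨t, ht0, ht1, h1, h2⟩ := (hseg p).1 hp1
    have hF := haff p t h1 h2
    rw [(mem_points ξ η h p).1 hp0] at hF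
    have htlt : t < 1 := by
      rcases ht1.eq_or_lt with rfl | h'
      · exact absurd (ext_coord (by rw [h1]; ring) (by rw [h2]; ring)) hp2
      · exact h'
    by_contra hcon
    obtain ⟨hc1, hc2⟩ := not_or.1 hcon
    have hc1 := not_lt.1 hc1
    by_cases hx0 : lineEq ξ η x = 0
    · have hy0 : lineEq ξ η y = 0 := by
        by_contra h'
        exact hc2 ⟨hx0, h'⟩
      have hxp : x = p := by
        have : x ∈ (Geodesic.mk ξ η h).points ∩ (seg x y \ {y}) :=
          ⟨hx0, by simp [seg], hxy⟩
        rwa [hp] at this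
      obtain ⟨m, hm1, hm2⟩ := exists_point x y (1 / 2) (by norm_num) (by norm_num)
      have hmy : m ≠ y := by
        intro hmy
        rw [hmy] at hm1 hm2
        exact hxy (ext_coord (by linarith) (by linarith))
      have hmp : m = p := by
        have : m ∈ (Geodesic.mk ξ η h).points ∩ (seg x y \ {y}) := by
          refine ⟨?_, (hseg m).2 ⟨1 / 2, by norm_num, by norm_num, hm1, hm2⟩, hmy⟩
          rw [mem_points, haff m _ hm1 hm2, hx0, hy0]
          ring
        rwa [hp] at this
      rw [hmp, ← hxp] at hm1 hm2
      exact hxy (ext_coord (by linarith) (by linarith))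
    · have hsq : 0 < lineEq ξ η x * lineEq ξ η x := mul_self_pos.2 hx0
      have h3 : 0 = (1 - t) * (lineEq ξ η x * lineEq ξ η x) +
          t * (lineEq ξ η x * lineEq ξ η y) := by
        linear_combination lineEq ξ η x * hF
      have h4 : 0 < (1 - t) * (lineEq ξ η x * lineEq ξ η x) := mul_pos (by linarith) hsq
      have h5 : 0 ≤ t * (lineEq ξ η x * lineEq ξ η y) := mul_nonneg ht0 hc1
      linarith
  · intro hs
    have hy0 : lineEq ξ η y ≠ 0 := by
      rcases hs with h' | h'
      · intro h0
        rw [h0, mul_zero] at h'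
        exact lt_irrefl _ h'
      · exact h'.2
    have hne : lineEq ξ η x - lineEq ξ η y ≠ 0 := by
      intro h0
      rw [sub_eq_zero.1 h0] at hs
      rcases hs with h' | h'
      · exact absurd h' (not_lt.2 (mul_self_nonneg _))
      · exact h'.2 h'.1
    obtain ⟨t, ht0, ht1, ht⟩ : ∃ t : ℝ, 0 ≤ t ∧ t ≤ 1 ∧
        (1 - t) * lineEq ξ η x + t * lineEq ξ η y = 0 := by
      have hprod : lineEq ξ η x * lineEq ξ η y ≤ 0 := by
        rcases hs with h' | h'
        · exact h'.le
        · rw [h'.1, zero_mul]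
      refine ⟨lineEq ξ η x / (lineEq ξ η x - lineEq ξ η y), ?_, ?_, ?_⟩
      · rw [← mul_div_mul_right _ _ hne]
        exact div_nonneg (by nlinarith [mul_self_nonneg (lineEq ξ η x)]) (mul_self_nonneg _)
      · rw [← mul_div_mul_right _ _ hne]
        refine div_le_one_of_le₀ ?_ (mul_self_nonneg _)
        nlinarith [mul_self_nonneg (lineEq ξ η y)]
      · field_simp
        ring
    obtain ⟨p, hp1, hp2⟩ := exists_point x y t ht0 ht1
    have hFp : lineEq ξ η p = 0 := by rw [haff p t hp1 hp2, ht]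
    refine ⟨p, Set.eq_singleton_iff_unique_mem.2 ⟨⟨hFp, (hseg p).2 ⟨t, ht0, ht1, hp1, hp2⟩, ?_⟩, ?_⟩⟩
    · rintro rfl
      exact hy0 hFp
    · rintro q ⟨hq0, hq1, -⟩
      obtain ⟨s, -, -, h1, h2⟩ := (hseg q).1 hq1
      have hF := haff q s h1 h2
      rw [(mem_points ξ η h q).1 hq0] at hF
      have hst : s = t := by
        have : (s - t) * (lineEq ξ η x - lineEq ξ η y) = 0 := by
          linear_combination hF + ht
        exact sub_eq_zero.1 ((mul_eq_zero.1 this).resolve_right hne)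
      rw [hst] at h1 h2
      exact ext_coord (by rw [h1, hp1]) (by rw [h2, hp2])

theorem seg_comm (x y : ℍ) : seg x y = seg y x := by
  ext z
  change dist x z + dist z y = dist x y ↔ dist y z + dist z x = dist y x
  rw [dist_comm y z, dist_comm z x, dist_comm y x, add_comm]

theorem transversal_subset (x y z : ℍ) : transversal (seg x z \ {z}) ⊆
    transversal (seg x y \ {y}) ∪ transversal (seg y z \ {z}) := by
  intro γ
  induction γ using Quotient.ind with
  | _ p =>
    obtain ⟨⟨ξ, η⟩, h⟩ := p
    change Geodesic.mk ξ η h ∈ _ → Geodesic.mk ξ η h ∈ _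
    rw [mem_union, mem_transversal_iff, mem_transversal_iff, mem_transversal_iff]
    generalize lineEq ξ η x = a
    generalize lineEq ξ η y = b
    generalize lineEq ξ η z = c
    rcases lt_trichotomy a 0 with ha | rfl | ha <;> rcases lt_trichotomy b 0 with hb | rfl | hb <;>
      rcases lt_trichotomy c 0 with hc | rfl | hc <;>
      simp [mul_neg_iff, *, ne_of_gt, ne_of_lt, not_lt_of_gt]

theorem edistCurrent_self (m : Measure Geodesic) (x : ℍ) : edistCurrent m x x = 0 := by
  have h : transversal (seg x x \ {x}) = ∅ := by
    rw [eq_empty_iff_forall_notMem]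
    intro γ
    induction γ using Quotient.ind with
    | _ p =>
      obtain ⟨⟨ξ, η⟩, h⟩ := p
      change ¬ (Geodesic.mk ξ η h ∈ _)
      rw [mem_transversal_iff]
      rintro (h' | ⟨h1, h2⟩)
      · exact absurd h' (not_lt.2 (mul_self_nonneg _))
      · exact absurd h1 h2
  simp [edistCurrent, h]

theorem edistCurrent_comm (m : Measure Geodesic) (x y : ℍ) :
    edistCurrent m x y = edistCurrent m y x := by
  simp only [edistCurrent, seg_comm x y, add_comm]

theorem edistCurrent_triangle (m : Measure Geodesic) (x y z : ℍ) :
    edistCurrent m x z ≤ edistCurrent m x y + edistCurrent m y z := by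
  have h1 := (measure_mono (μ := m) (transversal_subset x y z)).trans (measure_union_le _ _)
  have h2 := (measure_mono (μ := m) (transversal_subset z y x)).trans (measure_union_le _ _)
  rw [seg_comm z x, seg_comm z y, seg_comm y x] at h2
  simp only [edistCurrent]
  rw [← ENNReal.add_div]
  refine ENNReal.div_le_div_right ((add_le_add h1 h2).trans_eq ?_) 2
  ring

/-- The geodesics crossing a segment lie in a compact set, so their measure is finite. -/
theorem measure_transversal_ne_top (m : Measure Geodesic) [IsLocallyFiniteMeasure m] (x y : ℍ) :
    m (transversal (seg x y \ {y})) ≠ ∞ := by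
  set ε : ℝ := x.im * Real.exp (-dist x y) with hε
  set R : ℝ := |x.re| + |y.re| + x.im * Real.exp (dist x y) with hR
  have hε0 : 0 < ε := mul_pos x.im_pos (Real.exp_pos _)
  let C : Set (Boundary × Boundary) :=
    (((fun a : ℝ => (a : Boundary)) '' Icc (-R) R) ×ˢ univ) \
      (Prod.map (fun a : ℝ => (a : Boundary)) (fun a : ℝ => (a : Boundary)) ''
        {p : ℝ × ℝ | |p.1 - p.2| < ε})
  have hC : IsCompact C := by
    refine ((isCompact_Icc.image OnePoint.continuous_coe).prod isCompact_univ).diff ?_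
    refine (OnePoint.isOpenEmbedding_coe.prodMap OnePoint.isOpenEmbedding_coe).isOpenMap _ ?_
    exact isOpen_lt (by fun_prop) continuous_const
  have hC' : IsCompact {p : DistinctPair | p.1 ∈ C} := by
    rw [Subtype.isCompact_iff]
    convert hC using 1
    ext p
    constructor
    · rintro ⟨q, hq, rfl⟩
      exact hq
    · intro hp
      refine ⟨⟨p, ?_⟩, hp, rfl⟩
      intro h12
      obtain ⟨⟨⟨a, -, ha⟩, -⟩, hn⟩ := hp
      refine hn ⟨(a, a), by simpa using hε0, ?_⟩
      exact Prod.ext ha (ha.trans h12)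
  have hK : IsCompact (Quotient.mk flipSetoid '' {p : DistinctPair | p.1 ∈ C} : Set Geodesic) :=
    hC'.image continuous_quotient_mk'
  refine ((measure_mono ?_).trans_lt hK.measure_lt_top).ne
  intro γ
  induction γ using Quotient.ind with
  | _ p =>
  obtain ⟨⟨ξ, η⟩, h⟩ := p
  rintro ⟨p, hp⟩
  change (Geodesic.mk ξ η h).points ∩ _ = _ at hp
  obtain ⟨hp0, hp1, -⟩ : p ∈ (Geodesic.mk ξ η h).points ∩ (seg x y \ {y}) := by rw [hp]; rfl
  have hp0 : lineEq ξ η p = 0 := hp0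
  have hd : dist x p ≤ dist x y := by
    have : dist x p + dist p y = dist x y := hp1
    linarith [dist_nonneg (x := p) (y := y)]
  have him1 : ε ≤ p.im := by
    have h1 := UpperHalfPlane.im_le_im_mul_exp_dist x p
    have h2 : x.im ≤ p.im * Real.exp (dist x y) := h1.trans
      (mul_le_mul_of_nonneg_left (Real.exp_le_exp.2 hd) p.im_pos.le)
    rw [hε, Real.exp_neg]
    exact (div_le_iff₀ (Real.exp_pos _)).2 h2
  have him2 : p.im ≤ x.im * Real.exp (dist x y) := by
    have h1 := UpperHalfPlane.im_le_im_mul_exp_dist p x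
    rw [dist_comm] at h1
    exact h1.trans (mul_le_mul_of_nonneg_left (Real.exp_le_exp.2 hd) x.im_pos.le)
  have hre : |p.re| ≤ |x.re| + |y.re| := by
    obtain ⟨t, h0, h1, h2, -⟩ := (mem_seg_iff x y p).1 hp1
    rw [h2]
    refine (abs_add_le _ _).trans (add_le_add ?_ ?_)
    · rw [abs_mul, abs_of_nonneg (by linarith)]
      exact mul_le_of_le_one_left (abs_nonneg _) (by linarith)
    · rw [abs_mul, abs_of_nonneg h0]
      exact mul_le_of_le_one_left (abs_nonneg _) h1
  have hre' := abs_le.1 hre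
  have hpi := p.im_pos
  have hvert : ∀ a : ℝ, p.re - a = 0 → ((a : Boundary), (OnePoint.infty : Boundary)) ∈ C := by
    intro a ha
    refine ⟨⟨⟨a, ⟨by linarith, by linarith⟩, rfl⟩, mem_univ _⟩, ?_⟩
    rintro ⟨⟨b, c⟩, -, hbc⟩
    exact OnePoint.coe_ne_infty c (congrArg Prod.snd hbc)
  have hcirc : ∀ a b : ℝ, (p.re - a) * (p.re - b) + p.im ^ 2 = 0 → |p.re - a| ≤ p.im →
      ((a : Boundary), (b : Boundary)) ∈ C := by
    intro a b hab ha
    have ha' := abs_le.1 ha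
    refine ⟨⟨⟨a, ⟨by linarith, by linarith⟩, rfl⟩, mem_univ _⟩, ?_⟩
    rintro ⟨⟨a', b'⟩, hlt, hbc⟩
    obtain rfl : a' = a := OnePoint.coe_injective (congrArg Prod.fst hbc)
    obtain rfl : b' = b := OnePoint.coe_injective (congrArg Prod.snd hbc)
    have hlt : |a' - b'| < ε := hlt
    have : |a' - b'| < p.im := hlt.trans_le him1
    have h1 : (a' - b') ^ 2 < p.im ^ 2 := sq_lt_sq.2 (by rwa [abs_of_pos hpi])
    nlinarith [sq_nonneg (p.re - a'), sq_nonneg (p.re - b')]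
  have hor : (ξ, η) ∈ C ∨ (η, ξ) ∈ C := by
    induction ξ using OnePoint.rec with
    | infty =>
      induction η using OnePoint.rec with
      | infty => exact absurd rfl h
      | coe b => exact Or.inr (hvert b (by simpa [lineEq] using hp0))
    | coe a =>
      induction η using OnePoint.rec with
      | infty => exact Or.inl (hvert a (by simpa [lineEq] using hp0))
      | coe b =>
        have hp0 : (p.re - a) * (p.re - b) + p.im ^ 2 = 0 := by simpa [lineEq] using hp0
        by_cases ha : |p.re - a| ≤ p.im
        · exact Or.inl (hcirc a b hp0 ha)
        · refine Or.inr (hcirc b a (by linarith) ?_)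
          by_contra hb
          have h1 := mul_lt_mul'' (not_le.1 ha) (not_le.1 hb) hpi.le hpi.le
          rw [← abs_mul, show (p.re - a) * (p.re - b) = -p.im ^ 2 by linarith, abs_neg,
            abs_of_nonneg (sq_nonneg _)] at h1
          linarith
  rcases hor with h' | h'
  · exact ⟨⟨(ξ, η), h⟩, h', rfl⟩
  · exact ⟨⟨(η, ξ), h.symm⟩, h', Quotient.sound (Or.inr rfl)⟩

theorem edistCurrent_ne_top (m : Measure Geodesic) [IsLocallyFiniteMeasure m] (x y : ℍ) :
    edistCurrent m x y ≠ ∞ := by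
  have h2 := measure_transversal_ne_top m y x
  rw [seg_comm y x] at h2
  exact ENNReal.div_ne_top (ENNReal.add_ne_top.2 ⟨measure_transversal_ne_top m x y, h2⟩)
    two_ne_zero

/-! ### The dual space and its hyperbolicity -/

/-- A copy of the upper half-plane, to be equipped with the pseudo-distance `d_μ`. -/
structure PreDual {Γ : Subgroup SL(2, ℝ)} (μ : GeodesicCurrent Γ) where
  point : ℍ

/-- The pseudo-distance `d_μ` of a geodesic current. -/
noncomputable instance {Γ : Subgroup SL(2, ℝ)} (μ : GeodesicCurrent Γ) :
    PseudoMetricSpace (PreDual μ) where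
  dist x y := (edistCurrent μ.measure x.point y.point).toReal
  dist_self x := by simp [edistCurrent_self]
  dist_comm x y := congrArg ENNReal.toReal (edistCurrent_comm _ _ _)
  dist_triangle x y z := by
    have := μ.locallyFinite
    rw [← ENNReal.toReal_add (edistCurrent_ne_top _ _ _) (edistCurrent_ne_top _ _ _)]
    exact ENNReal.toReal_mono
      (ENNReal.add_ne_top.2 ⟨edistCurrent_ne_top _ _ _, edistCurrent_ne_top _ _ _⟩)
      (edistCurrent_triangle _ _ _ _)

/-- The dual space `X_μ` of a geodesic current: the metric space obtained from `(ℍ, d_μ)` by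
identifying points at distance zero. -/
abbrev DualSpace {Γ : Subgroup SL(2, ℝ)} (μ : GeodesicCurrent Γ) : Type :=
  SeparationQuotient (PreDual μ)

/-- The four-point condition: for any four points, the two largest among
`d(x, y) + d(z, w)`, `d(x, z) + d(y, w)`, `d(y, z) + d(x, w)` differ by at most `2 δ`, that is,
each of the three sums exceeds the maximum of the two others by at most `2 δ`. -/
def IsGromovHyperbolic (Y : Type*) [MetricSpace Y] (δ : ℝ) : Prop :=
  ∀ x y z w : Y,
    dist x y + dist z w ≤ max (dist x z + dist y w) (dist y z + dist x w) + 2 * δ ∧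
    dist x z + dist y w ≤ max (dist x y + dist z w) (dist y z + dist x w) + 2 * δ ∧
    dist y z + dist x w ≤ max (dist x y + dist z w) (dist x z + dist y w) + 2 * δ

end GeodesicCurrents

/-! A geodesic is the zero set of a function `lineEq ξ η` that is affine in the coordinates (re z,
|z|²). The half-open segments in the definition of d_μ are arranged so that 2 d_μ(x, y) is the
integral over all geodesics of the distance between the signs in {-1, 0, 1} of this function at x
and at y (`lintegral_crossing`, `crossing_mk`). Comparing sums of two distances thus reduces to
finite inequalities between four signs.

Upper bound. The sum d(x,y) + d(z,w) exceeds d(x,z) + d(y,w) only because of geodesics that separate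
{x,z} from {y,w}, and by at most twice their measure (`edistCurrent_add_le`). Exchanging x and y,
the other sum d(y,z) + d(x,w) is treated with the geodesics separating {y,z} from {x,w}. Let X, Y be
the ends of the line through x, y and Z, W those of the line through z, w. Separating geodesics also
separate the corresponding ends (`WeakSep.mem_sepSet`). If the two lines cross, the two families lie
in a box and in its opposite box; otherwise one family is empty (`min_sepSet_le`). So one of the two
measures is at most δ_μ.

Finiteness. Any box is a limit of boxes with real vertices and open sides (`Box.exists_reals`). The
common perpendicular of two opposite sides of the ideal quadrilateral on the vertices of such a box
has length at most 5 for one of the two choices, and it is crossed by all geodesics of the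
corresponding box (`exists_seg_of_box`). Cocompactness moves this segment into a fixed ball, and the
geodesics meeting a compact set have finite measure (`exists_bound_transversal`).

Optimality. For a real box with vertices A < B < C < D, let x, z tend to A, C along the line AC and
y, w to B, D along the line BD. The diagonals cross, so no geodesic separates {x,z} from {y,w}, and
the sign inequality holds in the reverse direction. It then gains twice the measure of the geodesics
separating {x,y} from {z,w}, and likewise {x,w} from {y,z}; these families exhaust the two opposite
boxes in the limit (`exists_four_points`). Hence d(x,z) + d(y,w) exceeds both other sums by nearly 2
min(μ(B), μ(B^⊥)). -/

namespace GeodesicCurrents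

/-! ### The equation of a geodesic at infinity -/

/-- The determinant of two points of the projective line, with representatives `(a, 1)` of real
points and `(1, 0)` of `∞`. Its sign is that of the difference of the two points, cut at `∞`. -/
noncomputable def bracket (s t : Boundary) : ℝ :=
  s.elim (t.elim 0 (fun _ => -1)) (fun a => t.elim 1 (fun b => b - a))

/-- The leading coefficient of the equation `lineEq ξ η` at a point at infinity. -/
noncomputable def bdEq (ξ η t : Boundary) : ℝ :=
  ξ.elim (η.elim 1 (fun b => t.elim 0 (fun t => t - b)))
    (fun a => η.elim (t.elim 0 (fun t => t - a)) (fun b => t.elim 1 (fun t => (t - a) * (t - b))))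

/-- As a quadratic form on the projective line the equation factors through its two zeros. The sign
c = ±1 depends on ξ and η only, so it disappears from products of two values, which is all that
separation involves. -/
theorem bdEq_eq_bracket (ξ η : Boundary) (h : ξ ≠ η) : ∃ c : ℝ, c * c = 1 ∧
    ∀ t, bdEq ξ η t = c * (bracket ξ t * bracket η t) := by
  induction ξ using OnePoint.rec with
  | infty =>
    induction η using OnePoint.rec with
    | infty => exact absurd rfl h
    | coe b =>
      refine ⟨-1, by norm_num, fun t => ?_⟩
      induction t using OnePoint.rec <;> simp [bdEq, bracket]
  | coe a =>
    induction η using OnePoint.rec with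
    | infty =>
      refine ⟨-1, by norm_num, fun t => ?_⟩
      induction t using OnePoint.rec <;> simp [bdEq, bracket]
    | coe b =>
      refine ⟨1, by norm_num, fun t => ?_⟩
      induction t using OnePoint.rec <;> simp [bdEq, bracket]

@[simp] theorem cut_coe (a : ℝ) : cut (a : Boundary) = (a : EReal) := rfl

@[simp] theorem cut_infty : cut OnePoint.infty = ⊤ := rfl

theorem cut_injective : Function.Injective cut := by
  intro s t h
  induction s using OnePoint.rec <;> induction t using OnePoint.rec <;> simp_all

theorem bracket_pos_iff (s t : Boundary) : 0 < bracket s t ↔ cut s < cut t := by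
  induction s using OnePoint.rec <;> induction t using OnePoint.rec <;> simp [bracket]

theorem bracket_neg_iff (s t : Boundary) : bracket s t < 0 ↔ cut t < cut s := by
  induction s using OnePoint.rec <;> induction t using OnePoint.rec <;> simp [bracket]

theorem bracket_self (s : Boundary) : bracket s s = 0 := by
  induction s using OnePoint.rec <;> simp [bracket]

/-- The two sides of a geodesic, for points at infinity. -/
theorem bdEq_mul_bdEq (ξ η : Boundary) (h : ξ ≠ η) (s t : Boundary) :
    bdEq ξ η s * bdEq ξ η t =
      (bracket ξ s * bracket ξ t) * (bracket η s * bracket η t) := by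
  obtain ⟨c, hc, hb⟩ := bdEq_eq_bracket ξ η h
  rw [hb, hb]
  linear_combination (bracket ξ s * bracket η s * (bracket ξ t * bracket η t)) * hc

/-! ### Lines and their ends -/

/-- The points `x, y` lie on the line from `X` to `Y`, in this order. -/
def IsLineEnds (x y : ℍ) (X Y : Boundary) : Prop :=
  ∃ α β α' β' : ℝ, 0 < α ∧ 0 < β ∧ 0 < α' ∧ 0 < β' ∧ α' * β < α * β' ∧ ∀ ξ η, ξ ≠ η →
    lineEq ξ η x = α * bdEq ξ η X + β * bdEq ξ η Y ∧
    lineEq ξ η y = α' * bdEq ξ η X + β' * bdEq ξ η Y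

theorem IsLineEnds.symm {x y : ℍ} {X Y : Boundary} (h : IsLineEnds x y X Y) :
    IsLineEnds y x Y X := by
  obtain ⟨α, β, α', β', h1, h2, h3, h4, h5, h6⟩ := h
  refine ⟨β', α', β, α, h4, h3, h2, h1, by linarith, fun ξ η hne => ⟨?_, ?_⟩⟩
  · rw [(h6 ξ η hne).2, add_comm]
  · rw [(h6 ξ η hne).1, add_comm]

/-- Cramer's rule: the order of x, y on the line makes the determinant αβ' - α'β positive, and
solving for the values at the ends gives strict signs even if the equation vanishes at one of the
two points. -/
theorem IsLineEnds.pos_neg {x y : ℍ} {X Y : Boundary} (h : IsLineEnds x y X Y) {ξ η : Boundary}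
    (hne : ξ ≠ η) (hs : (0 < lineEq ξ η x ∧ lineEq ξ η y ≤ 0) ∨
      (0 ≤ lineEq ξ η x ∧ lineEq ξ η y < 0)) : 0 < bdEq ξ η X ∧ bdEq ξ η Y < 0 := by
  obtain ⟨α, β, α', β', h1, h2, h3, h4, h5, h6⟩ := h
  rw [(h6 ξ η hne).1, (h6 ξ η hne).2] at hs
  generalize bdEq ξ η X = F at *
  generalize bdEq ξ η Y = G at *
  have k1 : 0 < (α * β' - α' * β) * F := by
    rcases hs with ⟨i, j⟩ | ⟨i, j⟩
    · have := mul_pos i h4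
      have := mul_nonneg (neg_nonneg.2 j) h2.le
      linarith
    · have := mul_nonneg i h4.le
      have := mul_pos (neg_pos.2 j) h2
      linarith
  have k2 : 0 < (α * β' - α' * β) * (-G) := by
    rcases hs with ⟨i, j⟩ | ⟨i, j⟩
    · have := mul_pos i h3
      have := mul_nonneg (neg_nonneg.2 j) h1.le
      linarith
    · have := mul_nonneg i h3.le
      have := mul_pos (neg_pos.2 j) h1
      linarith
  have hD : 0 < α * β' - α' * β := by linarith
  exact ⟨(mul_pos_iff_of_pos_left hD).1 k1, neg_pos.1 ((mul_pos_iff_of_pos_left hD).1 k2)⟩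

/-- In the coordinates (re z, |z|²) the line is |z|² = m re z + k, and its ends are the roots p < q
of t² = m t + k. On it (im z)² = (re z - p)(q - re z), so the weights of the ends are those of re z
as a convex combination of p and q. -/
theorem exists_isLineEnds_of_re_lt (x y : ℍ) (h : x.re < y.re) :
    ∃ X Y, IsLineEnds x y X Y := by
  obtain ⟨u, hu⟩ : ∃ u, u = x.re := ⟨_, rfl⟩
  obtain ⟨v, hv⟩ : ∃ v, v = y.re := ⟨_, rfl⟩
  have hx := x.im_pos
  have hy := y.im_pos
  obtain ⟨m, hm⟩ : ∃ m : ℝ, v ^ 2 + y.im ^ 2 - (u ^ 2 + x.im ^ 2) = m * (v - u) :=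
    ⟨(v ^ 2 + y.im ^ 2 - (u ^ 2 + x.im ^ 2)) / (v - u),
      (div_mul_cancel₀ _ (by rw [hu, hv]; linarith)).symm⟩
  obtain ⟨k, hk⟩ : ∃ k : ℝ, k = u ^ 2 + x.im ^ 2 - m * u := ⟨_, rfl⟩
  have hD : 0 < m ^ 2 + 4 * k := by
    rw [hk]
    have := sq_nonneg (m - 2 * u)
    nlinarith
  obtain ⟨r, hr⟩ : ∃ r, r = √(m ^ 2 + 4 * k) := ⟨_, rfl⟩
  have hr0 : 0 < r := by rw [hr]; exact Real.sqrt_pos.2 hD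
  have hr2 : r ^ 2 = m ^ 2 + 4 * k := by rw [hr]; exact Real.sq_sqrt hD.le
  obtain ⟨p, hp⟩ : ∃ p, p = (m - r) / 2 := ⟨_, rfl⟩
  obtain ⟨q, hq⟩ : ∃ q, q = (m + r) / 2 := ⟨_, rfl⟩
  have hpq : p < q := by rw [hp, hq]; linarith
  have hsum : m = p + q := by rw [hp, hq]; ring
  have hprod : k = - (p * q) := by
    rw [hp, hq]; linear_combination (-1 / 4 : ℝ) * hr2
  have ex : x.im ^ 2 = (u - p) * (q - u) := by
    rw [hsum] at hk; linear_combination hprod - hk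
  have ey : y.im ^ 2 = (v - p) * (q - v) := by
    rw [hsum] at hk hm; linear_combination hprod - hk + hm
  have key : ∀ w i : ℝ, 0 < i → i ^ 2 = (w - p) * (q - w) → p < w ∧ w < q := by
    intro w i hi hw
    have h0 : 0 < (w - p) * (q - w) := by rw [← hw]; positivity
    rcases pos_and_pos_or_neg_and_neg_of_mul_pos h0 with ⟨h1, h2⟩ | ⟨h1, h2⟩
    · exact ⟨by linarith, by linarith⟩
    · linarith
  obtain ⟨u1, u2⟩ := key u _ hx ex
  obtain ⟨v1, v2⟩ := key v _ hy ey
  have huv : u < v := by rw [hu, hv]; exact h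
  have hd : 0 < q - p := by linarith
  have hd0 := hd.ne'
  have main : ∀ w : ℍ, w.im ^ 2 = (w.re - p) * (q - w.re) → ∀ ξ η, ξ ≠ η →
      lineEq ξ η w = (q - w.re) / (q - p) * bdEq ξ η p + (w.re - p) / (q - p) * bdEq ξ η q := by
    intro w hw ξ η hne
    induction ξ using OnePoint.rec with
    | infty =>
      induction η using OnePoint.rec with
      | infty => exact absurd rfl hne
      | coe b => simp only [lineEq, bdEq, OnePoint.elim_some, OnePoint.elim_infty]; field_simp; ring
    | coe a =>
      induction η using OnePoint.rec with
      | infty => simp only [lineEq, bdEq, OnePoint.elim_some, OnePoint.elim_infty]; field_simp; ring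
      | coe b =>
        simp only [lineEq, bdEq, OnePoint.elim_some]
        rw [hw]
        field_simp
        ring
  refine ⟨p, q, (q - u) / (q - p), (u - p) / (q - p), (q - v) / (q - p), (v - p) / (q - p),
    div_pos (by linarith) hd, div_pos (by linarith) hd, div_pos (by linarith) hd,
    div_pos (by linarith) hd, ?_, fun ξ η hne => ⟨?_, ?_⟩⟩
  · rw [div_mul_div_comm, div_mul_div_comm]
    refine div_lt_div_of_pos_right ?_ (mul_pos hd hd)
    have : 0 < (v - u) * (q - p) := mul_pos (by linarith) hd
    linarith
  · rw [hu]; exact main x (by rw [← hu]; exact ex) ξ η hne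
  · rw [hv]; exact main y (by rw [← hv]; exact ey) ξ η hne

/-- On a vertical line the second end is ∞, where `bdEq` takes the coefficient of |z|² in the
equation; this is why ∞ carries the weight (im z)². -/
theorem exists_isLineEnds_of_re_eq (x y : ℍ) (h : x.re = y.re) (h' : x.im < y.im) :
    ∃ X Y, IsLineEnds x y X Y := by
  have hx := x.im_pos
  have hy := y.im_pos
  refine ⟨x.re, OnePoint.infty, 1, x.im ^ 2, 1, y.im ^ 2, one_pos, by positivity, one_pos,
    by positivity, ?_, fun ξ η hne => ?_⟩
  · rw [one_mul, one_mul]; exact pow_lt_pow_left₀ h' hx.le two_ne_zero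
  · induction ξ using OnePoint.rec with
    | infty =>
      induction η using OnePoint.rec with
      | infty => exact absurd rfl hne
      | coe b => simp [lineEq, bdEq, h]
    | coe a =>
      induction η using OnePoint.rec with
      | infty => simp [lineEq, bdEq, h]
      | coe b => simp [lineEq, bdEq, h]

/-- Two distinct points lie on a line. -/
theorem exists_isLineEnds (x y : ℍ) (h : x ≠ y) : ∃ X Y, IsLineEnds x y X Y := by
  rcases lt_trichotomy x.re y.re with h1 | h1 | h1
  · exact exists_isLineEnds_of_re_lt x y h1
  · rcases lt_trichotomy x.im y.im with h2 | h2 | h2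
    · exact exists_isLineEnds_of_re_eq x y h1 h2
    · exact absurd (UpperHalfPlane.ext_re_im h1 h2) h
    · obtain ⟨X, Y, hXY⟩ := exists_isLineEnds_of_re_eq y x h1.symm h2
      exact ⟨Y, X, hXY.symm⟩
  · obtain ⟨X, Y, hXY⟩ := exists_isLineEnds_of_re_lt y x h1
    exact ⟨Y, X, hXY.symm⟩

/-- The point on the line between two real points at infinity with given barycentric
coordinates. -/
theorem exists_barycenter {s t : ℝ} (hst : s ≠ t) {α β : ℝ} (hα : 0 < α) (hβ : 0 < β) :
    ∃ z : ℍ, (α + β) * z.re = α * s + β * t ∧ (α + β) * z.im = √(α * β) * |s - t| ∧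
      ∀ ξ η, ξ ≠ η → (α + β) * lineEq ξ η z = α * bdEq ξ η s + β * bdEq ξ η t := by
  have hs : 0 < α + β := by linarith
  have hs0 := hs.ne'
  have hi : 0 < √(α * β) * |s - t| / (α + β) :=
    div_pos (mul_pos (Real.sqrt_pos.2 (mul_pos hα hβ)) (abs_pos.2 (sub_ne_zero.2 hst))) hs
  let z : ℍ := ⟨⟨(α * s + β * t) / (α + β), √(α * β) * |s - t| / (α + β)⟩, hi⟩
  have h1 : (α + β) * z.re = α * s + β * t := mul_div_cancel₀ _ hs0
  have h2 : (α + β) * z.im = √(α * β) * |s - t| := mul_div_cancel₀ _ hs0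
  refine ⟨z, h1, h2, fun ξ η hne => ?_⟩
  have h3 : ((α + β) * z.im) ^ 2 = α * β * (s - t) ^ 2 := by
    rw [h2, mul_pow, Real.sq_sqrt (mul_pos hα hβ).le, sq_abs]
  induction ξ using OnePoint.rec with
  | infty =>
    induction η using OnePoint.rec with
    | infty => exact absurd rfl hne
    | coe b =>
      simp only [lineEq, bdEq, OnePoint.elim_some, OnePoint.elim_infty]
      linear_combination h1
  | coe a =>
    induction η using OnePoint.rec with
    | infty =>
      simp only [lineEq, bdEq, OnePoint.elim_some, OnePoint.elim_infty]
      linear_combination h1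
    | coe b =>
      simp only [lineEq, bdEq, OnePoint.elim_some]
      refine mul_left_cancel₀ hs0 ?_
      linear_combination h3 + ((α + β) * z.re + α * s + β * t - (a + b) * (α + β)) * h1

/-! ### Measurability of sets of geodesics -/

/-- The equivalence classes are the orbits of a continuous involution, so the saturation of an open
set O is the union of O and its swapped image. -/
theorem isOpenMap_mk : IsOpenMap (Quotient.mk flipSetoid : DistinctPair → Geodesic) := by
  intro O hO
  refine isQuotientMap_quotient_mk'.isOpen_preimage.1 ?_
  have hswap : Continuous (fun p : DistinctPair => (⟨p.1.swap, p.2.symm⟩ : DistinctPair)) := by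
    fun_prop
  convert hO.union (hO.preimage hswap) using 1
  ext p
  constructor
  · rintro ⟨q, hq, hqp⟩
    rcases Quotient.exact hqp with h | h
    · left
      rwa [← Subtype.ext h]
    · right
      have : q = ⟨p.1.swap, p.2.symm⟩ := Subtype.ext h
      rwa [this] at hq
  · rintro (h | h)
    · exact ⟨p, h, rfl⟩
    · exact ⟨_, h, Quotient.sound (Or.inr rfl)⟩

theorem Geodesic.mk_eq_mk_iff {ξ η ξ' η' : Boundary} (h : ξ ≠ η) (h' : ξ' ≠ η') :
    Geodesic.mk ξ η h = Geodesic.mk ξ' η' h' ↔ (ξ = ξ' ∧ η = η') ∨ (ξ = η' ∧ η = ξ') := by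
  constructor
  · intro e
    rcases Quotient.exact e with e | e
    · exact Or.inl (Prod.ext_iff.1 e)
    · exact Or.inr (Prod.ext_iff.1 e)
  · rintro (⟨rfl, rfl⟩ | ⟨rfl, rfl⟩)
    · rfl
    · exact Quotient.sound (Or.inr rfl)

theorem Geodesic.mk_comm {ξ η : Boundary} (h : ξ ≠ η) :
    Geodesic.mk ξ η h = Geodesic.mk η ξ h.symm :=
  (Geodesic.mk_eq_mk_iff h h.symm).2 (Or.inr ⟨rfl, rfl⟩)

/-- The geodesic with two real endpoints. -/
def Geodesic.ofReals (p : {p : ℝ × ℝ // p.1 < p.2}) : Geodesic :=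
  Geodesic.mk p.1.1 p.1.2 (fun h => p.2.ne (OnePoint.coe_injective h))

/-- The vertical geodesic. -/
def Geodesic.vertical (a : ℝ) : Geodesic := Geodesic.mk a OnePoint.infty (OnePoint.coe_ne_infty a)

/-- Together with `measurableEmbedding_vertical` this provides charts: geodesics with two real
endpoints form an open piece, parametrized by a < b, and the vertical ones form its closed
complement, parametrized by ℝ. -/
theorem Geodesic.measurableEmbedding_ofReals : MeasurableEmbedding Geodesic.ofReals := by
  have hc : Continuous (fun p : {p : ℝ × ℝ // p.1 < p.2} =>
      (⟨((p.1.1 : Boundary), (p.1.2 : Boundary)),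
        fun h => p.2.ne (OnePoint.coe_injective h)⟩ : DistinctPair)) := by
    refine Continuous.subtype_mk ?_ _
    exact ((OnePoint.continuous_coe.comp continuous_fst).prodMk
      (OnePoint.continuous_coe.comp continuous_snd)).comp continuous_subtype_val
  refine Topology.IsOpenEmbedding.measurableEmbedding
    (Topology.IsOpenEmbedding.of_continuous_injective_isOpenMap ?_ ?_ ?_)
  · exact continuous_quotient_mk'.comp hc
  · rintro ⟨⟨a, b⟩, h⟩ ⟨⟨c, d⟩, h'⟩ e
    have h : a < b := h
    have h' : c < d := h'
    rcases (Geodesic.mk_eq_mk_iff _ _).1 e with ⟨e1, e2⟩ | ⟨e1, e2⟩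
    · exact Subtype.ext (Prod.ext (OnePoint.coe_injective e1) (OnePoint.coe_injective e2))
    · have e1 : a = d := OnePoint.coe_injective e1
      have e2 : b = c := OnePoint.coe_injective e2
      linarith
  · refine isOpenMap_mk.comp ?_
    intro O hO
    have h1 : IsOpen (Subtype.val '' O) :=
      (isOpen_lt continuous_fst continuous_snd).isOpenEmbedding_subtypeVal.isOpenMap O hO
    have h2 := (OnePoint.isOpenEmbedding_coe.prodMap
      OnePoint.isOpenEmbedding_coe (X := ℝ) (Z := ℝ)).isOpenMap _ h1
    convert h2.preimage (continuous_subtype_val (p := fun p : Boundary × Boundary => p.1 ≠ p.2))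
      using 1
    ext q
    constructor
    · rintro ⟨p, hp, rfl⟩
      exact ⟨p.1, ⟨p, hp, rfl⟩, rfl⟩
    · rintro ⟨_, ⟨p, hp, rfl⟩, e⟩
      exact ⟨p, hp, Subtype.ext e⟩

theorem Geodesic.measurableEmbedding_vertical : MeasurableEmbedding Geodesic.vertical := by
  have hc : Continuous (fun a : ℝ =>
      (⟨((a : Boundary), (OnePoint.infty : Boundary)), OnePoint.coe_ne_infty a⟩ :
        DistinctPair)) :=
    Continuous.subtype_mk (OnePoint.continuous_coe.prodMk continuous_const) _
  have hcont : Continuous Geodesic.vertical := continuous_quotient_mk'.comp hc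
  -- `W O` is the open set of geodesics with an endpoint in O. A vertical geodesic has only one real
  -- endpoint, so `W O` traces exactly O on the verticals; this gives continuity of the inverse.
  let W : Set ℝ → Set Geodesic := fun O =>
    Quotient.mk flipSetoid '' {p : DistinctPair | p.1.1 ∈ (fun a : ℝ => (a : Boundary)) '' O}
  have hW : ∀ O, IsOpen O → IsOpen (W O) := fun O hO => isOpenMap_mk _
    ((OnePoint.isOpenEmbedding_coe.isOpenMap O hO).preimage
      (continuous_fst.comp continuous_subtype_val))
  have hpre : ∀ O, Geodesic.vertical ⁻¹' W O = O := by
    intro O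
    ext a
    constructor
    · rintro ⟨⟨⟨ξ, η⟩, h⟩, ⟨b, hb, hbξ⟩, e⟩
      have hbξ : (b : Boundary) = ξ := hbξ
      subst hbξ
      rcases (Geodesic.mk_eq_mk_iff h _).1 e with ⟨e1, e2⟩ | ⟨e1, e2⟩
      · rwa [← OnePoint.coe_injective e1]
      · exact absurd e1 (OnePoint.coe_ne_infty b)
    · intro ha
      exact ⟨_, ⟨a, ha, rfl⟩, rfl⟩
  have hemb : Topology.IsEmbedding Geodesic.vertical := by
    refine ⟨⟨le_antisymm hcont.le_induced ?_⟩, ?_⟩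
    · intro O hO
      exact isOpen_induced_iff.2 ⟨W O, hW O hO, hpre O⟩
    · intro a b e
      rcases (Geodesic.mk_eq_mk_iff _ _).1 e with ⟨e1, -⟩ | ⟨e1, -⟩
      · exact OnePoint.coe_injective e1
      · exact absurd e1 (OnePoint.coe_ne_infty a)
  refine hemb.measurableEmbedding ?_
  have hU : IsOpen (Quotient.mk flipSetoid '' {p : DistinctPair |
      p.1 ∈ range (fun a : ℝ => (a : Boundary)) ×ˢ range (fun a : ℝ => (a : Boundary))} :
        Set Geodesic) :=
    isOpenMap_mk _ ((OnePoint.isOpen_range_coe.prod OnePoint.isOpen_range_coe).preimage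
      continuous_subtype_val)
  convert hU.measurableSet.compl using 1
  ext γ
  constructor
  · rintro ⟨a, rfl⟩ ⟨⟨⟨ξ, η⟩, h⟩, ⟨⟨b, hb⟩, ⟨c, hc⟩⟩, e⟩
    have hb : (b : Boundary) = ξ := hb
    have hc : (c : Boundary) = η := hc
    rcases (Geodesic.mk_eq_mk_iff h _).1 e with ⟨e1, e2⟩ | ⟨e1, e2⟩
    · exact OnePoint.coe_ne_infty c (hc.trans e2)
    · exact OnePoint.coe_ne_infty b (hb.trans e1)
  · induction γ using Quotient.ind with
    | _ p =>
    obtain ⟨⟨ξ, η⟩, h⟩ := p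
    intro hγ
    induction ξ using OnePoint.rec with
    | infty =>
      induction η using OnePoint.rec with
      | infty => exact absurd rfl h
      | coe b => exact ⟨b, Quotient.sound (Or.inr rfl)⟩
    | coe a =>
      induction η using OnePoint.rec with
      | infty => exact ⟨a, rfl⟩
      | coe b => exact absurd ⟨_, ⟨⟨a, rfl⟩, ⟨b, rfl⟩⟩, rfl⟩ hγ

/-- The two charts cover the space of geodesics, so P is the union of two images of measurable sets
under measurable embeddings. -/
theorem Geodesic.measurableSet_of_preimage {P : Set Geodesic}
    (h1 : MeasurableSet (Geodesic.ofReals ⁻¹' P)) (h2 : MeasurableSet (Geodesic.vertical ⁻¹' P)) :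
    MeasurableSet P := by
  convert (Geodesic.measurableEmbedding_ofReals.measurableSet_image.2 h1).union
    (Geodesic.measurableEmbedding_vertical.measurableSet_image.2 h2) using 1
  ext γ
  constructor
  · intro hγ
    induction γ using Quotient.ind with
    | _ p =>
    obtain ⟨⟨ξ, η⟩, h⟩ := p
    induction ξ using OnePoint.rec with
    | infty =>
      induction η using OnePoint.rec with
      | infty => exact absurd rfl h
      | coe b =>
        have e : Geodesic.vertical b = Quotient.mk flipSetoid ⟨(OnePoint.infty, (b : Boundary)), h⟩ :=
          Quotient.sound (Or.inr rfl)
        rw [← e] at hγ ⊢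
        exact Or.inr ⟨b, hγ, rfl⟩
    | coe a =>
      induction η using OnePoint.rec with
      | infty => exact Or.inr ⟨a, hγ, rfl⟩
      | coe b =>
        left
        rcases lt_trichotomy a b with hab | hab | hab
        · exact ⟨⟨(a, b), hab⟩, hγ, rfl⟩
        · exact absurd (congrArg _ hab) h
        · have e : Geodesic.ofReals ⟨(b, a), hab⟩ =
              Quotient.mk flipSetoid ⟨((a : Boundary), (b : Boundary)), h⟩ :=
            Quotient.sound (Or.inr rfl)
          rw [← e] at hγ ⊢
          exact ⟨_, hγ, rfl⟩
  · rintro (⟨_, h, rfl⟩ | ⟨_, h, rfl⟩) <;> exact h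

theorem measurableSet_transversal (x y : ℍ) : MeasurableSet (transversal (seg x y \ {y})) := by
  have hset : ∀ {α : Type} [MeasurableSpace α] (f g : α → ℝ), Measurable f → Measurable g →
      MeasurableSet {a | f a * g a < 0 ∨ (f a = 0 ∧ g a ≠ 0)} := by
    intro α _ f g hf hg
    exact (measurableSet_lt (hf.mul hg) measurable_const).union
      ((measurableSet_eq_fun hf measurable_const).inter
        (measurableSet_eq_fun hg measurable_const).compl)
  refine Geodesic.measurableSet_of_preimage ?_ ?_
  · convert hset (fun p : {p : ℝ × ℝ // p.1 < p.2} => (x.re - p.1.1) * (x.re - p.1.2) + x.im ^ 2)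
      (fun p : {p : ℝ × ℝ // p.1 < p.2} => (y.re - p.1.1) * (y.re - p.1.2) + y.im ^ 2)
      (by fun_prop) (by fun_prop) using 1
    ext p
    exact mem_transversal_iff _ _ _ x y
  · convert hset (fun a : ℝ => x.re - a) (fun a : ℝ => y.re - a) (by fun_prop) (by fun_prop) using 1
    ext a
    exact mem_transversal_iff _ _ _ x y

/-! ### Distances as integrals -/

/-- How often a geodesic counts in twice the distance from `x` to `y`. -/
noncomputable def crossing (x y : ℍ) (γ : Geodesic) : ℝ≥0∞ :=
  (transversal (seg x y \ {y})).indicator 1 γ + (transversal (seg y x \ {x})).indicator 1 γ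

theorem measurable_crossing (x y : ℍ) : Measurable (crossing x y) :=
  (measurable_one.indicator (measurableSet_transversal x y)).add
    (measurable_one.indicator (measurableSet_transversal y x))

theorem lintegral_crossing (m : Measure Geodesic) (x y : ℍ) :
    ∫⁻ γ, crossing x y γ ∂m = 2 * edistCurrent m x y := by
  simp only [crossing]
  rw [lintegral_add_left (measurable_one.indicator (measurableSet_transversal x y)),
    lintegral_indicator_one (measurableSet_transversal x y),
    lintegral_indicator_one (measurableSet_transversal y x), edistCurrent, seg_comm y x,
    ENNReal.mul_div_cancel two_ne_zero ENNReal.ofNat_ne_top]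

/-- The distance of two signs. -/
def signDist (s t : SignType) : ℕ := ((s : ℤ) - t).natAbs

/-- A geodesic strictly between x and y meets both half-open segments and counts twice; one passing
through exactly one of x, y meets just one of them and counts once; one containing both points is
not transverse and counts zero. -/
theorem crossing_mk (x y : ℍ) (ξ η : Boundary) (h : ξ ≠ η) : crossing x y (Geodesic.mk ξ η h) =
    (signDist (SignType.sign (lineEq ξ η x)) (SignType.sign (lineEq ξ η y)) : ℝ≥0∞) := by
  classical
  simp only [crossing, indicator_apply, mem_transversal_iff]
  generalize lineEq ξ η x = a
  generalize lineEq ξ η y = b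
  rcases lt_trichotomy a 0 with ha | rfl | ha <;> rcases lt_trichotomy b 0 with hb | rfl | hb <;>
    simp [signDist, mul_neg_iff, *, ne_of_gt, ne_of_lt, not_lt_of_gt, one_add_one_eq_two]

/-- The signs `s₁, s₂` are on one side and `s₃, s₄` on the other side of a cut. -/
def CutSigns (s₁ s₂ s₃ s₄ : SignType) : Prop :=
  (0 < s₁ ∧ 0 < s₂ ∧ s₃ ≤ 0 ∧ s₄ ≤ 0) ∨ (0 ≤ s₁ ∧ 0 ≤ s₂ ∧ s₃ < 0 ∧ s₄ < 0) ∨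
  (s₁ < 0 ∧ s₂ < 0 ∧ 0 ≤ s₃ ∧ 0 ≤ s₄) ∨ (s₁ ≤ 0 ∧ s₂ ≤ 0 ∧ 0 < s₃ ∧ 0 < s₄)

instance (s₁ s₂ s₃ s₄ : SignType) : Decidable (CutSigns s₁ s₂ s₃ s₄) := by
  unfold CutSigns; infer_instance

/-- For points of a line, the left sum exceeds the sum on the right only if {s₁, s₃} lies entirely
on one side of {s₂, s₄}, and then by twice the gap. Among the values -1, 0, 1 a positive gap is
exactly `CutSigns`, and it is at most 2. -/
theorem signDist_add_le (s₁ s₂ s₃ s₄ : SignType) : signDist s₁ s₂ + signDist s₃ s₄ ≤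
    signDist s₁ s₃ + signDist s₂ s₄ + if CutSigns s₁ s₃ s₂ s₄ then 4 else 0 := by
  revert s₁ s₂ s₃ s₄
  decide

/-- The extra condition forces s₁ = s₂ and s₃ = s₄ to be opposite non-zero signs: the distances on
the left vanish and those on the right add up to 4. -/
theorem signDist_add_le_of_not (s₁ s₂ s₃ s₄ : SignType) (h : ¬ CutSigns s₁ s₃ s₂ s₄) :
    signDist s₁ s₂ + signDist s₃ s₄ + (if (s₁ * s₃ < 0 ∧ s₁ * s₄ < 0 ∧ s₂ * s₃ < 0) then 4 else 0) ≤
    signDist s₁ s₃ + signDist s₂ s₄ := by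
  revert s₁ s₂ s₃ s₄
  decide

/-- The geodesic with equation `F = lineEq ξ η` separates, weakly, `x, y` from `z, w`. -/
def WeakSep (x y z w : ℍ) (ξ η : Boundary) : Prop :=
  CutSigns (SignType.sign (lineEq ξ η x)) (SignType.sign (lineEq ξ η y))
    (SignType.sign (lineEq ξ η z)) (SignType.sign (lineEq ξ η w))

/-- This integrates `signDist_add_le`. The set S need not be measurable, since the integral of the
indicator of any set is at most its measure. -/
theorem edistCurrent_add_le (m : Measure Geodesic) (x y z w : ℍ) (S : Set Geodesic)
    (hS : ∀ ξ η h, WeakSep x z y w ξ η → Geodesic.mk ξ η h ∈ S) :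
    edistCurrent m x y + edistCurrent m z w ≤
      edistCurrent m x z + edistCurrent m y w + 2 * m S := by
  classical
  have h : ∀ γ, crossing x y γ + crossing z w γ ≤
      crossing x z γ + crossing y w γ + S.indicator (fun _ => 4) γ := by
    intro γ
    induction γ using Quotient.ind with
    | _ p =>
    obtain ⟨⟨ξ, η⟩, h⟩ := p
    have e : Quotient.mk flipSetoid ⟨(ξ, η), h⟩ = Geodesic.mk ξ η h := rfl
    simp only [e, crossing_mk]
    have key := signDist_add_le (SignType.sign (lineEq ξ η x)) (SignType.sign (lineEq ξ η y))
      (SignType.sign (lineEq ξ η z)) (SignType.sign (lineEq ξ η w))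
    have key' : ((_ : ℕ) : ℝ≥0∞) ≤ ((_ : ℕ) : ℝ≥0∞) := Nat.cast_le.2 key
    rw [Nat.cast_add, Nat.cast_add, Nat.cast_add] at key'
    refine key'.trans (add_le_add le_rfl ?_)
    split_ifs with hc
    · rw [indicator_of_mem (hS ξ η h hc)]; norm_num
    · simp
  have h2 := lintegral_mono (μ := m) h
  rw [lintegral_add_left (measurable_crossing x y), lintegral_add_left
    (f := fun γ => crossing x z γ + crossing y w γ)
    ((measurable_crossing x z).add (measurable_crossing y w)),
    lintegral_add_left (measurable_crossing x z)] at h2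
  simp only [lintegral_crossing] at h2
  have h3 := h2.trans (add_le_add le_rfl (lintegral_indicator_const_le S 4))
  refine (ENNReal.mul_le_mul_iff_right two_ne_zero ENNReal.ofNat_ne_top).1 ?_
  calc _ = _ := mul_add _ _ _
    _ ≤ _ := h3
    _ = _ := by ring

/-- This integrates `signDist_add_le_of_not`. A lower bound of an integral needs a measurable set,
so S is enlarged to the set R cut out by the same strict sign conditions. -/
theorem add_le_edistCurrent_add (m : Measure Geodesic) (x y z w : ℍ) (S : Set Geodesic)
    (hw : ∀ ξ η, ξ ≠ η → ¬ WeakSep x z y w ξ η)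
    (hS : ∀ γ ∈ S, ∃ ξ η, ∃ h : ξ ≠ η, γ = Geodesic.mk ξ η h ∧ lineEq ξ η x * lineEq ξ η z < 0 ∧
      lineEq ξ η x * lineEq ξ η w < 0 ∧ lineEq ξ η y * lineEq ξ η z < 0) :
    edistCurrent m x y + edistCurrent m z w + 2 * m S ≤
      edistCurrent m x z + edistCurrent m y w := by
  classical
  let N : ℍ → ℍ → Set Geodesic := fun p q =>
    transversal (seg p q \ {q}) ∩ transversal (seg q p \ {p})
  have hN : ∀ p q ξ η h, Geodesic.mk ξ η h ∈ N p q ↔ lineEq ξ η p * lineEq ξ η q < 0 := by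
    intro p q ξ η h
    simp only [N, mem_inter_iff, mem_transversal_iff]
    rw [mul_comm (lineEq ξ η q)]
    tauto
  have hNm : ∀ p q, MeasurableSet (N p q) := fun p q =>
    (measurableSet_transversal p q).inter (measurableSet_transversal q p)
  let R : Set Geodesic := N x z ∩ (N x w ∩ N y z)
  have hR : MeasurableSet R := (hNm _ _).inter ((hNm _ _).inter (hNm _ _))
  have hSR : S ⊆ R := by
    intro γ hγ
    obtain ⟨ξ, η, h, rfl, h1, h2, h3⟩ := hS γ hγ
    exact ⟨(hN _ _ _ _ h).2 h1, (hN _ _ _ _ h).2 h2, (hN _ _ _ _ h).2 h3⟩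
  have h : ∀ γ, crossing x y γ + crossing z w γ + R.indicator (fun _ => 4) γ ≤
      crossing x z γ + crossing y w γ := by
    intro γ
    induction γ using Quotient.ind with
    | _ p =>
    obtain ⟨⟨ξ, η⟩, h⟩ := p
    have e : Quotient.mk flipSetoid ⟨(ξ, η), h⟩ = Geodesic.mk ξ η h := rfl
    simp only [e, crossing_mk]
    have key := signDist_add_le_of_not (SignType.sign (lineEq ξ η x))
      (SignType.sign (lineEq ξ η y)) (SignType.sign (lineEq ξ η z)) (SignType.sign (lineEq ξ η w))
      (hw ξ η h)
    have key' : ((_ : ℕ) : ℝ≥0∞) ≤ ((_ : ℕ) : ℝ≥0∞) := Nat.cast_le.2 key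
    rw [Nat.cast_add, Nat.cast_add, Nat.cast_add] at key'
    refine le_trans (add_le_add le_rfl ?_) key'
    by_cases hmem : Geodesic.mk ξ η h ∈ R
    · obtain ⟨h1, h2, h3⟩ := hmem
      rw [hN, ← sign_eq_neg_one_iff, sign_mul] at h1 h2 h3
      rw [if_pos ⟨by rw [h1]; decide, by rw [h2]; decide, by rw [h3]; decide⟩]
      exact (indicator_le_self' (fun _ _ => bot_le) _).trans (by norm_num)
    · rw [indicator_of_notMem hmem]
      exact bot_le
  have h2 := lintegral_mono (μ := m) h
  rw [lintegral_add_left (measurable_crossing x z), lintegral_add_left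
    (f := fun γ => crossing x y γ + crossing z w γ)
    ((measurable_crossing x y).add (measurable_crossing z w)),
    lintegral_add_left (measurable_crossing x y), lintegral_indicator_const hR] at h2
  simp only [lintegral_crossing] at h2
  refine (ENNReal.mul_le_mul_iff_right two_ne_zero ENNReal.ofNat_ne_top).1 ?_
  calc _ = 2 * edistCurrent m x y + 2 * edistCurrent m z w + 4 * m S := by ring
    _ ≤ _ := (add_le_add le_rfl (mul_le_mul_right (measure_mono hSR) 4)).trans h2
    _ = _ := by ring

/-! ### Boxes and separation of points at infinity -/

/-- The geodesics separating `P, Q` from `R, S`. -/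
def sepSet (P Q R S : Boundary) : Set Geodesic :=
  {γ | ∃ ξ η, ∃ h : ξ ≠ η, γ = Geodesic.mk ξ η h ∧ 0 < bdEq ξ η P * bdEq ξ η Q ∧
    bdEq ξ η P * bdEq ξ η R < 0 ∧ 0 < bdEq ξ η R * bdEq ξ η S}

theorem sepSet_swap_subset (P Q R S : Boundary) : sepSet P Q R S ⊆ sepSet R S P Q := by
  rintro _ ⟨ξ, η, h, rfl, h1, h2, h3⟩
  exact ⟨ξ, η, h, rfl, h3, by rwa [mul_comm], h1⟩

theorem sepSet_swap (P Q R S : Boundary) : sepSet P Q R S = sepSet R S P Q :=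
  (sepSet_swap_subset _ _ _ _).antisymm (sepSet_swap_subset _ _ _ _)

theorem sepSet_comm_right_subset (P Q R S : Boundary) : sepSet P Q R S ⊆ sepSet P Q S R := by
  rintro _ ⟨ξ, η, h, rfl, h1, h2, h3⟩
  refine ⟨ξ, η, h, rfl, h1, ?_, by rwa [mul_comm]⟩
  have h4 := mul_neg_of_neg_of_pos h2 h3
  have h5 : 0 < bdEq ξ η R * bdEq ξ η R := mul_self_pos.2 (left_ne_zero_of_mul h3.ne')
  by_contra h6
  have h7 := mul_nonneg (not_lt.1 h6) h5.le
  linarith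

theorem sepSet_comm_right (P Q R S : Boundary) : sepSet P Q R S = sepSet P Q S R :=
  (sepSet_comm_right_subset _ _ _ _).antisymm (sepSet_comm_right_subset _ _ _ _)

theorem sepSet_comm_left (P Q R S : Boundary) : sepSet P Q R S = sepSet Q P R S := by
  rw [sepSet_swap, sepSet_comm_right, sepSet_swap]

/-! ### Separation of points at infinity in terms of the order cut at ∞ -/

theorem bracket_mul_pos {ξ s t : Boundary} (hs : cut ξ ≠ cut s) (ht : cut ξ ≠ cut t) :
    0 < bracket ξ s * bracket ξ t ↔ (cut ξ < cut s ↔ cut ξ < cut t) := by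
  rw [mul_pos_iff, bracket_pos_iff, bracket_pos_iff, bracket_neg_iff, bracket_neg_iff]
  constructor
  · rintro (⟨h1, h2⟩ | ⟨h1, h2⟩)
    · exact iff_of_true h1 h2
    · exact iff_of_false h1.not_gt h2.not_gt
  · intro h
    rcases lt_or_gt_of_ne hs with h1 | h1
    · exact Or.inl ⟨h1, h.1 h1⟩
    · exact Or.inr ⟨h1, lt_of_le_of_ne (not_lt.1 fun h2 => h1.not_gt (h.2 h2)) ht.symm⟩

theorem bdEq_ne_zero {ξ η t : Boundary} (h : ξ ≠ η) (ht : bdEq ξ η t ≠ 0) :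
    cut ξ ≠ cut t ∧ cut η ≠ cut t := by
  obtain ⟨c, -, hc⟩ := bdEq_eq_bracket ξ η h
  rw [hc] at ht
  constructor
  · intro e
    rw [cut_injective e, bracket_self] at ht
    simp at ht
  · intro e
    rw [cut_injective e, bracket_self] at ht
    simp at ht

/-- Two points are on the same side of a geodesic iff an even number of its endpoints lies between
them. In this form separation is a propositional combination of order comparisons. -/
theorem bdEq_mul_pos_iff {ξ η s t : Boundary} (h : ξ ≠ η) (hs : bdEq ξ η s ≠ 0)
    (ht : bdEq ξ η t ≠ 0) : 0 < bdEq ξ η s * bdEq ξ η t ↔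
      ((cut ξ < cut s ↔ cut ξ < cut t) ↔ (cut η < cut s ↔ cut η < cut t)) := by
  have hs' := bdEq_ne_zero h hs
  have ht' := bdEq_ne_zero h ht
  rw [← bracket_mul_pos hs'.1 ht'.1, ← bracket_mul_pos hs'.2 ht'.2]
  have h1 := bdEq_mul_bdEq ξ η h s t
  have h2 : bdEq ξ η s * bdEq ξ η t ≠ 0 := mul_ne_zero hs ht
  rw [h1] at h2 ⊢
  have h3 := left_ne_zero_of_mul h2
  have h4 := right_ne_zero_of_mul h2
  constructor
  · intro h5
    rcases mul_pos_iff.1 h5 with ⟨i, j⟩ | ⟨i, j⟩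
    · exact iff_of_true i j
    · exact iff_of_false i.not_gt j.not_gt
  · intro h5
    rcases lt_or_gt_of_ne h3 with i | i
    · exact mul_pos_of_neg_of_neg i (lt_of_le_of_ne (not_lt.1 fun j => i.not_gt (h5.2 j)) h4)
    · exact mul_pos i (h5.1 i)

theorem exists_endpoints_of_mem_sepSet {P Q R S : Boundary} {γ : Geodesic} (hγ : γ ∈ sepSet P Q R S) :
    ∃ ξ η, ∃ h : ξ ≠ η, γ = Geodesic.mk ξ η h ∧
      (cut ξ ≠ cut P ∧ cut ξ ≠ cut Q ∧ cut ξ ≠ cut R ∧ cut ξ ≠ cut S) ∧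
      (cut η ≠ cut P ∧ cut η ≠ cut Q ∧ cut η ≠ cut R ∧ cut η ≠ cut S) ∧
      ((cut ξ < cut P ↔ cut ξ < cut Q) ↔ (cut η < cut P ↔ cut η < cut Q)) ∧
      ¬ ((cut ξ < cut P ↔ cut ξ < cut R) ↔ (cut η < cut P ↔ cut η < cut R)) ∧
      ((cut ξ < cut R ↔ cut ξ < cut S) ↔ (cut η < cut R ↔ cut η < cut S)) := by
  obtain ⟨ξ, η, h, rfl, h1, h2, h3⟩ := hγ
  have hP := left_ne_zero_of_mul h1.ne'
  have hQ := right_ne_zero_of_mul h1.ne'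
  have hR := left_ne_zero_of_mul h3.ne'
  have hS := right_ne_zero_of_mul h3.ne'
  have iP := bdEq_ne_zero h hP
  have iQ := bdEq_ne_zero h hQ
  have iR := bdEq_ne_zero h hR
  have iS := bdEq_ne_zero h hS
  rw [bdEq_mul_pos_iff h hP hQ] at h1
  rw [bdEq_mul_pos_iff h hR hS] at h3
  have h2' := h2.not_gt
  rw [bdEq_mul_pos_iff h hP hR] at h2'
  exact ⟨ξ, η, h, rfl, ⟨iP.1, iQ.1, iR.1, iS.1⟩, ⟨iP.2, iQ.2, iR.2, iS.2⟩, h1, h2', h3⟩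

theorem sepSet_self_left (P Q S : Boundary) : sepSet P Q P S = ∅ := by
  refine eq_empty_of_forall_notMem ?_
  rintro _ ⟨ξ, η, h, rfl, -, h2, -⟩
  exact absurd h2 (not_lt.2 (mul_self_nonneg _))

/-- No geodesic separates two linked pairs of points. -/
theorem sepSet_eq_empty {P Q R S : Boundary} (h1 : cut P < cut R) (h2 : cut R < cut Q)
    (h3 : cut Q < cut S) : sepSet P Q R S = ∅ := by
  refine eq_empty_of_forall_notMem fun γ hγ => ?_
  obtain ⟨ξ, η, h, rfl, h4, h5, h6, h7, h8⟩ := exists_endpoints_of_mem_sepSet hγ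
  -- Each endpoint enters only through its comparisons with the four points, and these are monotone
  -- along the chain of the four points. After recording this, what remains is propositional logic;
  -- the same device serves for the inclusions in boxes below.
  have a1 : cut ξ < cut P → cut ξ < cut R := fun h => h.trans h1
  have a2 : cut ξ < cut R → cut ξ < cut Q := fun h => h.trans h2
  have a3 : cut ξ < cut Q → cut ξ < cut S := fun h => h.trans h3
  have b1 : cut η < cut P → cut η < cut R := fun h => h.trans h1
  have b2 : cut η < cut R → cut η < cut Q := fun h => h.trans h2
  have b3 : cut η < cut Q → cut η < cut S := fun h => h.trans h3
  clear h4 h5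
  grind

/-! ### Separating sets as subsets of opposite boxes -/

theorem mem_openArc_of_lt {a b t : Boundary} (h : cut a < cut b) :
    t ∈ openArc a b ↔ cut a < cut t ∧ cut t < cut b := by
  simp only [openArc, mem_ofPred_eq]
  constructor
  · rintro (h' | h' | h')
    · exact h'
    · exact absurd (h'.2.trans h) (lt_irrefl _)
    · exact absurd (h'.1.trans h) (lt_irrefl _)
  · exact Or.inl

theorem mem_openArc_of_gt {a b t : Boundary} (h : cut a < cut b) :
    t ∈ openArc b a ↔ cut t < cut a ∨ cut b < cut t := by
  simp only [openArc, mem_ofPred_eq]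
  constructor
  · rintro (h' | h' | h')
    · exact absurd (h.trans (h'.1.trans h'.2)) (lt_irrefl _)
    · exact Or.inl h'.1
    · exact Or.inr h'.2
  · rintro (h' | h')
    · exact Or.inr (Or.inl ⟨h', h⟩)
    · exact Or.inr (Or.inr ⟨h, h'⟩)

theorem geodesicsBetween_comm (I J : Set Boundary) :
    geodesicsBetween I J = geodesicsBetween J I := by
  ext γ
  constructor <;>
  · rintro ⟨ξ, hξ, η, hη, h, rfl⟩
    exact ⟨η, hη, ξ, hξ, h.symm, Geodesic.mk_comm h⟩

theorem geodesicsBetween_mono {I I' J J' : Set Boundary} (h : I ⊆ I') (h' : J ⊆ J') :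
    geodesicsBetween I J ⊆ geodesicsBetween I' J' := by
  rintro _ ⟨ξ, hξ, η, hη, hne, rfl⟩
  exact ⟨ξ, h hξ, η, h' hη, hne, rfl⟩

theorem gt_iff_not_lt_of_ne {α : Type*} [LinearOrder α] {a b : α} (h : a ≠ b) :
    b < a ↔ ¬ a < b :=
  ⟨fun h' => h'.not_gt, fun h' => lt_of_le_of_ne (not_lt.1 h') h.symm⟩

/-- The geodesics separating `P, Q` from `R, S`, for points in cyclic order. -/
theorem sepSet_subset_geodesicsBetween {P Q R S : Boundary} (h1 : cut P < cut Q)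
    (h2 : cut Q < cut R) (h3 : cut R < cut S) :
    sepSet P Q R S ⊆ geodesicsBetween (openArc S P) (openArc Q R) := by
  intro γ hγ
  obtain ⟨ξ, η, h, rfl, ⟨x1, x2, x3, x4⟩, ⟨y1, y2, y3, y4⟩, h6, h7, h8⟩ := exists_endpoints_of_mem_sepSet hγ
  have key : (ξ ∈ openArc S P ∧ η ∈ openArc Q R) ∨ (η ∈ openArc S P ∧ ξ ∈ openArc Q R) := by
    simp only [mem_openArc_of_lt h2, mem_openArc_of_gt (h1.trans (h2.trans h3))]
    have a1 : cut ξ < cut P → cut ξ < cut Q := fun h => h.trans h1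
    have a2 : cut ξ < cut Q → cut ξ < cut R := fun h => h.trans h2
    have a3 : cut ξ < cut R → cut ξ < cut S := fun h => h.trans h3
    have b1 : cut η < cut P → cut η < cut Q := fun h => h.trans h1
    have b2 : cut η < cut Q → cut η < cut R := fun h => h.trans h2
    have b3 : cut η < cut R → cut η < cut S := fun h => h.trans h3
    rw [gt_iff_not_lt_of_ne x2, gt_iff_not_lt_of_ne x4, gt_iff_not_lt_of_ne y2, gt_iff_not_lt_of_ne y4]
    clear x1 x2 x3 x4 y1 y2 y3 y4
    grind
  rcases key with ⟨i, j⟩ | ⟨i, j⟩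
  · exact ⟨ξ, i, η, j, h, rfl⟩
  · exact ⟨η, i, ξ, j, h.symm, Geodesic.mk_comm h⟩

/-- The other way of grouping four cyclically ordered points into two pairs of neighbours, which
leads to the opposite box. -/
theorem sepSet_subset_geodesicsBetween' {P Q R S : Boundary} (h1 : cut P < cut Q)
    (h2 : cut Q < cut R) (h3 : cut R < cut S) :
    sepSet P S Q R ⊆ geodesicsBetween (openArc P Q) (openArc R S) := by
  intro γ hγ
  obtain ⟨ξ, η, h, rfl, ⟨x1, x2, x3, x4⟩, ⟨y1, y2, y3, y4⟩, h6, h7, h8⟩ := exists_endpoints_of_mem_sepSet hγ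
  have key : (ξ ∈ openArc P Q ∧ η ∈ openArc R S) ∨ (η ∈ openArc P Q ∧ ξ ∈ openArc R S) := by
    simp only [mem_openArc_of_lt h1, mem_openArc_of_lt h3]
    have a1 : cut ξ < cut P → cut ξ < cut Q := fun h => h.trans h1
    have a2 : cut ξ < cut Q → cut ξ < cut R := fun h => h.trans h2
    have a3 : cut ξ < cut R → cut ξ < cut S := fun h => h.trans h3
    have b1 : cut η < cut P → cut η < cut Q := fun h => h.trans h1
    have b2 : cut η < cut Q → cut η < cut R := fun h => h.trans h2
    have b3 : cut η < cut R → cut η < cut S := fun h => h.trans h3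
    rw [gt_iff_not_lt_of_ne x1, gt_iff_not_lt_of_ne x4, gt_iff_not_lt_of_ne y1, gt_iff_not_lt_of_ne y4]
    clear x1 x2 x3 x4 y1 y2 y3 y4
    grind
  rcases key with ⟨i, j⟩ | ⟨i, j⟩
  · exact ⟨ξ, i, η, j, h, rfl⟩
  · exact ⟨η, i, ξ, j, h.symm, Geodesic.mk_comm h⟩

/-- The box with half-open sides and given vertices. -/
def halfOpenBox (P Q R S : Boundary) (h1 : cut P < cut Q) (h2 : cut Q < cut R)
    (h3 : cut R < cut S) : Box where
  vertex := ![P, Q, R, S]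
  side := ![insert P (openArc P Q), insert Q (openArc Q R), insert R (openArc R S),
    insert S (openArc S P)]
  isArc i := by
    fin_cases i <;> exact ⟨⟨_, mem_insert _ _⟩, Or.inr (Or.inl rfl)⟩
  partition t := by
    have hi : ∀ s, t = s ↔ cut t = cut s := fun s => cut_injective.eq_iff.symm
    have k0 : t ∈ insert P (openArc P Q) ↔ ¬ cut t < cut P ∧ cut t < cut Q := by
      rw [mem_insert_iff, mem_openArc_of_lt h1, hi]
      grind
    have k1 : t ∈ insert Q (openArc Q R) ↔ ¬ cut t < cut Q ∧ cut t < cut R := by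
      rw [mem_insert_iff, mem_openArc_of_lt h2, hi]
      grind
    have k2 : t ∈ insert R (openArc R S) ↔ ¬ cut t < cut R ∧ cut t < cut S := by
      rw [mem_insert_iff, mem_openArc_of_lt h3, hi]
      grind
    have k3 : t ∈ insert S (openArc S P) ↔ cut t < cut P ∨ ¬ cut t < cut S := by
      rw [mem_insert_iff, mem_openArc_of_gt (h1.trans (h2.trans h3)), hi]
      grind
    have e : (∀ i : Fin 4, t ∈ (![insert P (openArc P Q), insert Q (openArc Q R),
        insert R (openArc R S), insert S (openArc S P)] : Fin 4 → Set Boundary) i ↔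
        (![¬ cut t < cut P ∧ cut t < cut Q, ¬ cut t < cut Q ∧ cut t < cut R,
          ¬ cut t < cut R ∧ cut t < cut S, cut t < cut P ∨ ¬ cut t < cut S] : Fin 4 → Prop) i) := by
      intro i
      fin_cases i
      exacts [k0, k1, k2, k3]
    simp only [e]
    -- The four conditions ask at which place the increasing chain of truth values `cut t < cut P`,
    -- …, `cut t < cut S` switches to true; the last side collects both extreme places.
    have a1 : cut t < cut P → cut t < cut Q := fun h => h.trans h1
    have a2 : cut t < cut Q → cut t < cut R := fun h => h.trans h2
    have a3 : cut t < cut R → cut t < cut S := fun h => h.trans h3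
    clear e k0 k1 k2 k3 hi
    simp only [ExistsUnique, Fin.exists_fin_succ, Fin.forall_fin_succ]
    simp
    grind

/-- Exchanging X with Y or Z with W permutes the two sets, and exchanging the two pairs preserves
them, so X may be taken smallest and Z ≤ W. If Y lies below Z or above W, the lines XY and ZW do not
cross and one of the sets separates linked pairs, hence is empty. If X < Z < Y < W, the two sets lie
in opposite boxes with these vertices. Coincidences among the points also make a set empty. -/
theorem min_sepSet_le {Γ : Subgroup SL(2, ℝ)} (μ : GeodesicCurrent Γ) (X Y Z W : Boundary) :
    min (μ.measure (sepSet X Z Y W)) (μ.measure (sepSet Y Z X W)) ≤ hypConst μ := by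
  wlog hXY : cut X ≤ cut Y generalizing X Y Z W
  · rw [min_comm]
    exact this Y X Z W (not_le.1 hXY).le
  wlog hZW : cut Z ≤ cut W generalizing X Y Z W
  · have := this X Y W Z hXY (not_le.1 hZW).le
    rwa [sepSet_swap X W, sepSet_swap Y W, min_comm] at this
  wlog hXZ : cut X ≤ cut Z generalizing X Y Z W
  · have := this Z W X Y hZW hXY (not_le.1 hXZ).le
    rwa [sepSet_comm_left Z, sepSet_comm_right _ _ W, sepSet_swap W, sepSet_comm_left Z,
      sepSet_comm_right _ _ W] at this
  rcases hXY.eq_or_lt with e | hXY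
  · rw [cut_injective e, sepSet_self_left]; simp
  rcases hZW.eq_or_lt with e | hZW
  · rw [cut_injective e, sepSet_comm_left, sepSet_comm_right, sepSet_self_left]; simp
  rcases hXZ.eq_or_lt with e | hXZ
  · rw [cut_injective e, sepSet_comm_left Y, sepSet_self_left]; simp
  rcases lt_trichotomy (cut Y) (cut Z) with h | h | h
  · rw [sepSet_eq_empty hXY h hZW]; simp
  · rw [cut_injective h, sepSet_comm_left, sepSet_self_left]; simp
  rcases lt_trichotomy (cut W) (cut Y) with h' | h' | h'
  · rw [sepSet_swap Y, sepSet_comm_right X W, sepSet_eq_empty hXZ hZW h']; simp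
  · rw [cut_injective h', sepSet_comm_right Y, sepSet_self_left]; simp
  refine le_trans (min_le_min ?_ ?_)
    ((min_comm _ _).trans_le (le_iSup (fun B : Box =>
      min (μ.measure B.carrier) (μ.measure B.opposite.carrier)) (halfOpenBox X Z Y W hXZ h h')))
  · exact measure_mono ((sepSet_subset_geodesicsBetween hXZ h h').trans
      (geodesicsBetween_mono (subset_insert _ _) (subset_insert _ _)))
  · rw [sepSet_swap, sepSet_comm_right]
    exact measure_mono ((sepSet_subset_geodesicsBetween' hXZ h h').trans
      (geodesicsBetween_mono (subset_insert _ _) (subset_insert _ _)))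

/-! ### Hyperbolicity -/

theorem cutSigns_sign (a b c d : ℝ) : CutSigns (SignType.sign a) (SignType.sign b)
    (SignType.sign c) (SignType.sign d) ↔
    (0 < a ∧ 0 < b ∧ c ≤ 0 ∧ d ≤ 0) ∨ (0 ≤ a ∧ 0 ≤ b ∧ c < 0 ∧ d < 0) ∨
    (a < 0 ∧ b < 0 ∧ 0 ≤ c ∧ 0 ≤ d) ∨ (a ≤ 0 ∧ b ≤ 0 ∧ 0 < c ∧ 0 < d) := by
  have h1 : ∀ r : ℝ, 0 < SignType.sign r ↔ 0 < r := fun r => by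
    rcases lt_trichotomy r 0 with h | rfl | h <;> simp [*, not_lt_of_gt]
  have h2 : ∀ r : ℝ, SignType.sign r < 0 ↔ r < 0 := fun r => by
    rcases lt_trichotomy r 0 with h | rfl | h <;> simp [*, not_lt_of_gt]
  simp only [CutSigns, h1, h2, sign_nonneg_iff, sign_nonpos_iff]

/-- A geodesic separating points separates the ends of lines through them. -/
theorem WeakSep.mem_sepSet {x y z w : ℍ} {X Y Z W ξ η : Boundary} (h : WeakSep x z y w ξ η)
    (hne : ξ ≠ η) (h1 : IsLineEnds x y X Y) (h2 : IsLineEnds z w Z W) :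
    Geodesic.mk ξ η hne ∈ sepSet X Z Y W := by
  refine ⟨ξ, η, hne, rfl, ?_⟩
  rw [WeakSep, cutSigns_sign] at h
  have key : (0 < bdEq ξ η X ∧ bdEq ξ η Y < 0 ∧ 0 < bdEq ξ η Z ∧ bdEq ξ η W < 0) ∨
      (0 < bdEq ξ η Y ∧ bdEq ξ η X < 0 ∧ 0 < bdEq ξ η W ∧ bdEq ξ η Z < 0) := by
    rcases h with ⟨a, b, c, d⟩ | ⟨a, b, c, d⟩ | ⟨a, b, c, d⟩ | ⟨a, b, c, d⟩
    · obtain ⟨i, j⟩ := h1.pos_neg hne (Or.inl ⟨a, c⟩)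
      obtain ⟨k, l⟩ := h2.pos_neg hne (Or.inl ⟨b, d⟩)
      exact Or.inl ⟨i, j, k, l⟩
    · obtain ⟨i, j⟩ := h1.pos_neg hne (Or.inr ⟨a, c⟩)
      obtain ⟨k, l⟩ := h2.pos_neg hne (Or.inr ⟨b, d⟩)
      exact Or.inl ⟨i, j, k, l⟩
    · obtain ⟨i, j⟩ := h1.symm.pos_neg hne (Or.inr ⟨c, a⟩)
      obtain ⟨k, l⟩ := h2.symm.pos_neg hne (Or.inr ⟨d, b⟩)
      exact Or.inr ⟨i, j, k, l⟩
    · obtain ⟨i, j⟩ := h1.symm.pos_neg hne (Or.inl ⟨c, a⟩)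
      obtain ⟨k, l⟩ := h2.symm.pos_neg hne (Or.inl ⟨d, b⟩)
      exact Or.inr ⟨i, j, k, l⟩
  rcases key with ⟨i, j, k, l⟩ | ⟨i, j, k, l⟩
  · exact ⟨mul_pos i k, mul_neg_of_pos_of_neg i j, mul_pos_of_neg_of_neg j l⟩
  · exact ⟨mul_pos_of_neg_of_neg j l, mul_neg_of_neg_of_pos j i, mul_pos i k⟩

theorem not_weakSep_self (x z w : ℍ) (ξ η : Boundary) : ¬ WeakSep x z x w ξ η := by
  rw [WeakSep, cutSigns_sign]
  rintro (⟨a, b, c, d⟩ | ⟨a, b, c, d⟩ | ⟨a, b, c, d⟩ | ⟨a, b, c, d⟩) <;> linarith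

theorem not_weakSep_self' (x y z : ℍ) (ξ η : Boundary) : ¬ WeakSep x z y z ξ η := by
  rw [WeakSep, cutSigns_sign]
  rintro (⟨a, b, c, d⟩ | ⟨a, b, c, d⟩ | ⟨a, b, c, d⟩ | ⟨a, b, c, d⟩) <;> linarith

/-- The four-point inequality of a geodesic current. -/
theorem edistCurrent_four_point {Γ : Subgroup SL(2, ℝ)} (μ : GeodesicCurrent Γ) (x y z w : ℍ) :
    edistCurrent μ.measure x y + edistCurrent μ.measure z w ≤
      max (edistCurrent μ.measure x z + edistCurrent μ.measure y w)
        (edistCurrent μ.measure y z + edistCurrent μ.measure x w) + 2 * hypConst μ := by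
  -- A degenerate pair spans no line, but no geodesic separates a point from itself, so the
  -- inequality holds without error term.
  by_cases hxy : x = y
  · subst hxy
    refine (edistCurrent_add_le μ.measure x x z w ∅
      fun ξ η h hs => absurd hs (not_weakSep_self x z w ξ η)).trans ?_
    exact add_le_add (le_max_left _ _) (by simp)
  by_cases hzw : z = w
  · subst hzw
    refine (edistCurrent_add_le μ.measure x y z z ∅
      fun ξ η h hs => absurd hs (not_weakSep_self' x y z ξ η)).trans ?_
    exact add_le_add (le_max_left _ _) (by simp)
  obtain ⟨X, Y, hXY⟩ := exists_isLineEnds x y hxy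
  obtain ⟨Z, W, hZW⟩ := exists_isLineEnds z w hzw
  -- Whichever set is small decides with which of the two sums in the maximum to compare; exchanging
  -- x and y, hence X and Y, passes from one to the other.
  rcases min_le_iff.1 (min_sepSet_le μ X Y Z W) with h | h
  · refine (edistCurrent_add_le μ.measure x y z w _
      fun ξ η hne hs => hs.mem_sepSet hne hXY hZW).trans ?_
    exact add_le_add (le_max_left _ _) (mul_le_mul_right h 2)
  · rw [edistCurrent_comm _ x y]
    refine (edistCurrent_add_le μ.measure y x z w _
      fun ξ η hne hs => hs.mem_sepSet hne hXY.symm hZW).trans ?_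
    exact add_le_add (le_max_right _ _) (mul_le_mul_right h 2)

/-! ### Reduction to boxes with real vertices and open sides -/

-- A lower set of reals is a cut, and it is approached from the side that leaves its supremum where
-- it belongs: from above if it is attained, from below if not, and by -n or n for the empty set or
-- ℝ. This turns closed, half-open and degenerate sides into open ones.
open Filter in
theorem exists_seq_of_isLowerSet (L : Set ℝ) (hL : IsLowerSet L) : ∃ u : ℕ → ℝ,
    ∀ t, (t ∈ L → ∀ᶠ n in atTop, t < u n) ∧ (t ∉ L → ∀ᶠ n in atTop, u n < t) := by
  have hlim := tendsto_one_div_add_atTop_nhds_zero_nat (𝕜 := ℝ)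
  have hev : ∀ ε : ℝ, 0 < ε → ∀ᶠ n : ℕ in atTop, 1 / ((n : ℝ) + 1) < ε :=
    fun ε hε => hlim.eventually_lt_const hε
  have hpos : ∀ n : ℕ, 0 < 1 / ((n : ℝ) + 1) := fun n => Nat.one_div_pos_of_nat
  rcases L.eq_empty_or_nonempty with rfl | hne
  · refine ⟨fun n => -n, fun t => ⟨fun h => absurd h (notMem_empty t), fun _ => ?_⟩⟩
    filter_upwards [tendsto_natCast_atTop_atTop.eventually_gt_atTop (-t)] with n hn
    linarith
  by_cases hb : BddAbove L
  · have hlub := isLUB_csSup hne hb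
    have hlt : ∀ t, t < sSup L → t ∈ L := by
      intro t ht
      obtain ⟨s, hs, hts⟩ := (lt_isLUB_iff hlub).1 ht
      exact hL hts.le hs
    by_cases hs : sSup L ∈ L
    · refine ⟨fun n => sSup L + 1 / (n + 1), fun t => ⟨fun ht => ?_, fun ht => ?_⟩⟩
      · refine Eventually.of_forall fun n => ?_
        have := hlub.1 ht
        have := hpos n
        linarith
      · have : sSup L < t := lt_of_le_of_ne (not_lt.1 fun h => ht (hlt t h))
          (fun h => ht (by rwa [← h]))
        filter_upwards [hev (t - sSup L) (by linarith)] with n hn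
        linarith
    · refine ⟨fun n => sSup L - 1 / (n + 1), fun t => ⟨fun ht => ?_, fun ht => ?_⟩⟩
      · have : t < sSup L := lt_of_le_of_ne (hlub.1 ht) (fun h => hs (by rwa [← h]))
        filter_upwards [hev (sSup L - t) (by linarith)] with n hn
        linarith
      · refine Eventually.of_forall fun n => ?_
        have : sSup L ≤ t := not_lt.1 fun h => ht (hlt t h)
        have := hpos n
        linarith
  · have hall : ∀ t, t ∈ L := by
      intro t
      obtain ⟨s, hs, hts⟩ := not_bddAbove_iff.1 hb t
      exact hL hts.le hs
    refine ⟨fun n => n, fun t => ⟨fun _ => ?_, fun h => absurd (hall t) h⟩⟩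
    exact tendsto_natCast_atTop_atTop.eventually_gt_atTop t

open Filter in
/-- If every point of `T` is eventually in `S n`, then `S n` has eventually almost the measure
of `T`. -/
theorem eventually_lt_measure {α : Type*} [MeasurableSpace α] (m : Measure α) {T : Set α}
    {S : ℕ → Set α} (hS : ∀ γ ∈ T, ∀ᶠ n in atTop, γ ∈ S n) {r : ℝ≥0∞} (hr : r < m T) :
    ∀ᶠ n in atTop, r < m (S n) := by
  -- The sets of points that stay in `S n` from N on increase with N and cover T. Continuity from
  -- below along a monotone sequence holds for outer measure, so no measurability is needed.
  let E : ℕ → Set α := fun N => {γ | ∀ n, N ≤ n → γ ∈ S n}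
  have hE : Monotone E := fun N M hNM γ hγ n hn => hγ n (hNM.trans hn)
  have hT : T ⊆ ⋃ N, E N := fun γ hγ => by
    obtain ⟨N, hN⟩ := eventually_atTop.1 (hS γ hγ)
    exact mem_iUnion.2 ⟨N, hN⟩
  have h1 := hr.trans_le (measure_mono hT)
  rw [hE.measure_iUnion] at h1
  obtain ⟨N, hN⟩ := lt_iSup_iff.1 h1
  filter_upwards [eventually_ge_atTop N] with n hn
  exact hN.trans_le (measure_mono fun γ hγ => hγ n hn)

/-! ### Order of the sides of a box whose last side contains ∞ -/

theorem openArc_self (a : Boundary) : openArc a a = ∅ := by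
  refine eq_empty_of_forall_notMem fun t => ?_
  simp only [openArc, mem_ofPred_eq]
  rintro (h | h | h)
  · exact lt_asymm h.1 h.2
  · exact lt_irrefl _ h.2
  · exact lt_irrefl _ h.1

theorem IsArc.openArc_subset {a b : Boundary} {I : Set Boundary} (h : IsArc a b I) :
    openArc a b ⊆ I := by
  rcases h.2 with rfl | rfl | rfl | rfl
  · exact subset_rfl
  · exact subset_insert _ _
  · exact subset_insert _ _
  · exact (subset_insert _ _).trans (subset_insert _ _)

theorem IsArc.mem {a b t : Boundary} {I : Set Boundary} (h : IsArc a b I) (ht : t ∈ I) :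
    t = a ∨ t = b ∨ t ∈ openArc a b := by
  rcases h.2 with rfl | rfl | rfl | rfl
  · exact Or.inr (Or.inr ht)
  · rcases ht with ht | ht
    · exact Or.inl ht
    · exact Or.inr (Or.inr ht)
  · rcases ht with ht | ht
    · exact Or.inr (Or.inl ht)
    · exact Or.inr (Or.inr ht)
  · exact ht

theorem IsArc.ne_infty {a b : Boundary} {I : Set Boundary} (h : IsArc a b I)
    (hI : OnePoint.infty ∉ I) : ¬ (a = OnePoint.infty ∧ b = OnePoint.infty) := by
  rintro ⟨rfl, rfl⟩
  obtain ⟨t, ht⟩ := h.1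
  rcases h.mem ht with rfl | rfl | h'
  · exact hI ht
  · exact hI ht
  · rw [openArc_self] at h'
    exact h'

theorem cut_eq_top_iff {a : Boundary} : cut a = ⊤ ↔ a = OnePoint.infty := by
  rw [← cut_infty, cut_injective.eq_iff]

/-- An arc avoiding ∞ is increasing in the cut order. The exception is a left vertex at ∞: it has
the largest value ⊤ although the arc then starts at the end -∞ of the real line. -/
theorem IsArc.le_of_infty_notMem {a b : Boundary} {I : Set Boundary} (h : IsArc a b I)
    (hI : OnePoint.infty ∉ I) : cut a = ⊤ ∨ cut a ≤ cut b := by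
  by_contra hcon
  rw [not_or, not_le] at hcon
  refine hI (h.openArc_subset (Or.inr (Or.inr ⟨hcon.2, ?_⟩)))
  exact lt_of_le_of_ne le_top hcon.1

theorem IsArc.le_right {a b t : Boundary} {I : Set Boundary} (h : IsArc a b I)
    (hI : OnePoint.infty ∉ I) (ht : t ∈ I) : cut t ≤ cut b := by
  have h0 := h.le_of_infty_notMem hI
  rcases h.mem ht with rfl | rfl | h' | h' | h'
  · rcases h0 with h0 | h0
    · exact absurd (cut_eq_top_iff.1 h0 ▸ ht) hI
    · exact h0
  · exact le_rfl
  · exact h'.2.le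
  · exact h'.1.le
  · rcases h0 with h0 | h0
    · exact absurd h'.2 (by rw [h0]; exact not_top_lt)
    · exact absurd h'.1 (not_lt.2 h0)

theorem IsArc.left_le {a b t : Boundary} {I : Set Boundary} (h : IsArc a b I)
    (hI : OnePoint.infty ∉ I) (ht : t ∈ I) : cut a = ⊤ ∨ cut a ≤ cut t := by
  have h0 := h.le_of_infty_notMem hI
  rcases h.mem ht with rfl | rfl | h' | h' | h'
  · exact Or.inr le_rfl
  · exact h0
  · exact Or.inr h'.1.le
  · rcases h0 with h0 | h0
    · exact Or.inl h0
    · exact absurd h'.2 (not_lt.2 h0)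
  · exact Or.inr h'.2.le

theorem Box.eq_of_mem (B : Box) {t : Boundary} {i j : Fin 4} (hi : t ∈ B.side i)
    (hj : t ∈ B.side j) : i = j := (B.partition t).unique hi hj

theorem exists_coe_of_ne_infty {a : Boundary} (h : a ≠ OnePoint.infty) : ∃ r : ℝ, a = r := by
  induction a using OnePoint.rec with
  | infty => exact absurd rfl h
  | coe r => exact ⟨r, rfl⟩

theorem Box.infty_notMem (B : Box) (hB : OnePoint.infty ∈ B.side 3) {i : Fin 4} (hi : i ≠ 3) :
    OnePoint.infty ∉ B.side i :=
  fun h => hi (B.eq_of_mem h hB)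

/-- The position of the end vertices of a last side containing `∞`. -/
theorem Box.infty_mem_side (B : Box) (hB : OnePoint.infty ∈ B.side 3) :
    cut (B.vertex 3) = ⊤ ∨ cut (B.vertex 0) = ⊤ ∨ cut (B.vertex 0) < cut (B.vertex 3) := by
  rcases (B.isArc 3).mem hB with h | h | h | h | h
  · exact Or.inl (by rw [← h]; rfl)
  · exact Or.inr (Or.inl (by rw [show B.vertex 0 = B.vertex (3 + 1) from rfl, ← h]; rfl))
  · exact absurd h.2 (by rw [cut_infty]; exact not_top_lt)
  · exact absurd h.1 (by rw [cut_infty]; exact not_top_lt)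
  · exact Or.inr (Or.inr h.1)

/-- Otherwise side 1 would start at ∞ and contain all sufficiently negative reals; but so does side
3, which contains ∞ and ends at a real vertex. -/
theorem Box.vertex_one_ne_infty (B : Box) (hB : OnePoint.infty ∈ B.side 3) :
    B.vertex 1 ≠ OnePoint.infty := by
  intro hv
  have h0 : IsArc (B.vertex 0) (B.vertex 1) (B.side 0) := B.isArc 0
  have h1 : IsArc (B.vertex 1) (B.vertex 2) (B.side 1) := B.isArc 1
  have h3 : IsArc (B.vertex 3) (B.vertex 0) (B.side 3) := B.isArc 3
  have i0 : B.vertex 0 ≠ OnePoint.infty := fun h =>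
    h0.ne_infty (B.infty_notMem hB (by decide)) ⟨h, hv⟩
  have i2 : B.vertex 2 ≠ OnePoint.infty := fun h =>
    h1.ne_infty (B.infty_notMem hB (by decide)) ⟨hv, h⟩
  have i3 := B.infty_mem_side hB
  obtain ⟨a, ha⟩ := exists_coe_of_ne_infty i0
  obtain ⟨c, hc⟩ := exists_coe_of_ne_infty i2
  rw [ha] at h3 i3
  rw [hv, hc] at h1
  have hs1 : min a c - 1 < a := by linarith [min_le_left a c]
  have hs2 : min a c - 1 < c := by linarith [min_le_right a c]
  generalize min a c - 1 = s at hs1 hs2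
  have k1 : (s : Boundary) ∈ B.side 1 := by
    refine h1.openArc_subset (Or.inr (Or.inl ⟨?_, ?_⟩))
    · exact EReal.coe_lt_coe_iff.2 hs2
    · exact EReal.coe_lt_top c
  have k3 : (s : Boundary) ∈ B.side 3 := by
    refine h3.openArc_subset (Or.inr (Or.inl ⟨EReal.coe_lt_coe_iff.2 hs1, ?_⟩))
    rcases i3 with i3 | i3 | i3
    · rw [i3]; exact EReal.coe_lt_top a
    · exact absurd i3 (EReal.coe_lt_top a).ne
    · exact i3
  exact absurd (B.eq_of_mem k1 k3) (by decide)

/-- The mirror image: side 1 ending at ∞ and side 3 starting at a real vertex would share all large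
reals. -/
theorem Box.vertex_two_ne_infty (B : Box) (hB : OnePoint.infty ∈ B.side 3) :
    B.vertex 2 ≠ OnePoint.infty := by
  intro hv
  have h1 : IsArc (B.vertex 1) (B.vertex 2) (B.side 1) := B.isArc 1
  have h2 : IsArc (B.vertex 2) (B.vertex 3) (B.side 2) := B.isArc 2
  have h3 : IsArc (B.vertex 3) (B.vertex 0) (B.side 3) := B.isArc 3
  have i1 : B.vertex 1 ≠ OnePoint.infty := fun h =>
    h1.ne_infty (B.infty_notMem hB (by decide)) ⟨h, hv⟩
  have i3 : B.vertex 3 ≠ OnePoint.infty := fun h =>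
    h2.ne_infty (B.infty_notMem hB (by decide)) ⟨hv, h⟩
  have i0 := B.infty_mem_side hB
  obtain ⟨b, hb⟩ := exists_coe_of_ne_infty i1
  obtain ⟨d, hd⟩ := exists_coe_of_ne_infty i3
  rw [hd] at h3 i0
  rw [hv, hb] at h1
  have hs1 : b < max b d + 1 := by linarith [le_max_left b d]
  have hs2 : d < max b d + 1 := by linarith [le_max_right b d]
  generalize max b d + 1 = s at hs1 hs2
  have k1 : (s : Boundary) ∈ B.side 1 := by
    refine h1.openArc_subset (Or.inl ⟨?_, ?_⟩)
    · exact EReal.coe_lt_coe_iff.2 hs1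
    · exact EReal.coe_lt_top s
  have k3 : (s : Boundary) ∈ B.side 3 := by
    refine h3.openArc_subset ?_
    rcases i0 with i0 | i0 | i0
    · exact absurd i0 (EReal.coe_lt_top d).ne
    · exact Or.inl ⟨EReal.coe_lt_coe_iff.2 hs2, by rw [i0]; exact EReal.coe_lt_top s⟩
    · exact Or.inr (Or.inr ⟨i0, EReal.coe_lt_coe_iff.2 hs2⟩)
  exact absurd (B.eq_of_mem k1 k3) (by decide)

/-- The common vertex is real, so it bounds one side from above and the next from below;
disjointness makes the inequality strict. -/
theorem Box.side_zero_lt_side_one (B : Box) (hB : OnePoint.infty ∈ B.side 3) {s t : Boundary}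
    (hs : s ∈ B.side 0) (ht : t ∈ B.side 1) : cut s < cut t := by
  have h0 : IsArc (B.vertex 0) (B.vertex 1) (B.side 0) := B.isArc 0
  have h1 : IsArc (B.vertex 1) (B.vertex 2) (B.side 1) := B.isArc 1
  have k0 := h0.le_right (B.infty_notMem hB (by decide)) hs
  have k1 := (h1.left_le (B.infty_notMem hB (by decide)) ht).resolve_left
    (fun h => B.vertex_one_ne_infty hB (cut_eq_top_iff.1 h))
  refine lt_of_le_of_ne (k0.trans k1) fun h => ?_
  rw [cut_injective h] at hs
  exact absurd (B.eq_of_mem hs ht) (by decide)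

theorem Box.side_one_lt_side_two (B : Box) (hB : OnePoint.infty ∈ B.side 3) {s t : Boundary}
    (hs : s ∈ B.side 1) (ht : t ∈ B.side 2) : cut s < cut t := by
  have h1 : IsArc (B.vertex 1) (B.vertex 2) (B.side 1) := B.isArc 1
  have h2 : IsArc (B.vertex 2) (B.vertex 3) (B.side 2) := B.isArc 2
  have k0 := h1.le_right (B.infty_notMem hB (by decide)) hs
  have k1 := (h2.left_le (B.infty_notMem hB (by decide)) ht).resolve_left
    (fun h => B.vertex_two_ne_infty hB (cut_eq_top_iff.1 h))
  refine lt_of_le_of_ne (k0.trans k1) fun h => ?_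
  rw [cut_injective h] at hs
  exact absurd (B.eq_of_mem hs ht) (by decide)

/-- A point between sides 0 and 2 would lie strictly after vertex 0, if that is real, and strictly
before vertex 3, so outside the arc from vertex 3 through ∞ to vertex 0. -/
theorem Box.side_three_outside (B : Box) (hB : OnePoint.infty ∈ B.side 3) {r s t : Boundary}
    (hs : s ∈ B.side 0) (ht : t ∈ B.side 2) (hr : r ∈ B.side 3) (hsr : cut s < cut r)
    (hrt : cut r < cut t) : False := by
  have h0 : IsArc (B.vertex 0) (B.vertex 1) (B.side 0) := B.isArc 0
  have h2 : IsArc (B.vertex 2) (B.vertex 3) (B.side 2) := B.isArc 2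
  have h3 : IsArc (B.vertex 3) (B.vertex 0) (B.side 3) := B.isArc 3
  have k0 := h0.left_le (B.infty_notMem hB (by decide)) hs
  have k2 := h2.le_right (B.infty_notMem hB (by decide)) ht
  have hr3 : cut r < cut (B.vertex 3) := hrt.trans_le k2
  have hr0 : cut (B.vertex 0) = ⊤ ∨ cut (B.vertex 0) < cut r := k0.imp_right fun h => h.trans_lt hsr
  have hrtop : cut r < ⊤ := hrt.trans_le le_top
  rcases h3.mem hr with h | h | h | h | h
  · exact absurd (h ▸ hr3) (lt_irrefl _)
  · rcases hr0 with i | i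
    · rw [← h] at i
      exact hrtop.ne i
    · exact absurd (h ▸ i) (lt_irrefl _)
  · exact lt_asymm h.1 hr3
  · rcases hr0 with i | i
    · exact absurd h.2 (by rw [i]; exact not_top_lt)
    · exact lt_asymm i h.1
  · exact lt_asymm hr3 h.2

open Filter in
/-- A box with `∞` in its last side is the limit of boxes with real vertices and open sides. -/
theorem Box.exists_seq (B : Box) (hB : OnePoint.infty ∈ B.side 3) : ∃ A C D E : ℕ → ℝ,
    (∀ᶠ n in atTop, A n < C n ∧ C n < D n ∧ D n < E n) ∧
    (∀ t ∈ B.side 0, ∀ᶠ n in atTop, t ∈ openArc (A n) (C n)) ∧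
    (∀ t ∈ B.side 1, ∀ᶠ n in atTop, t ∈ openArc (C n) (D n)) ∧
    (∀ t ∈ B.side 2, ∀ᶠ n in atTop, t ∈ openArc (D n) (E n)) ∧
    (∀ t ∈ B.side 3, ∀ᶠ n in atTop, t ∈ openArc (E n) (A n)) := by
  -- A, C, D approximate the cuts just below sides 0, 1, 2, and E the cut just above side 2, each
  -- placed so that every real point is eventually on its proper side.
  have hlow : ∀ I : Set Boundary, IsLowerSet {r : ℝ | ∀ s ∈ I, (r : EReal) < cut s} :=
    fun I a b hba ha s hs => (EReal.coe_le_coe_iff.2 hba).trans_lt (ha s hs)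
  obtain ⟨A, hA⟩ := exists_seq_of_isLowerSet _ (hlow (B.side 0))
  obtain ⟨C, hC⟩ := exists_seq_of_isLowerSet _ (hlow (B.side 1))
  obtain ⟨D, hD⟩ := exists_seq_of_isLowerSet _ (hlow (B.side 2))
  obtain ⟨E, hE⟩ := exists_seq_of_isLowerSet {r : ℝ | ∃ s ∈ B.side 2, (r : EReal) ≤ cut s}
    (fun a b hba ⟨s, hs, ha⟩ => ⟨s, hs, (EReal.coe_le_coe_iff.2 hba).trans ha⟩)
  have hreal : ∀ i : Fin 4, i ≠ 3 → ∀ t ∈ B.side i, ∃ r : ℝ, t = r := fun i hi t ht =>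
    exists_coe_of_ne_infty fun h => B.infty_notMem hB hi (h ▸ ht)
  have h0 : ∀ r : ℝ, (r : Boundary) ∈ B.side 0 → ∀ᶠ n in atTop, A n < r ∧ r < C n := by
    intro r hr
    refine ((hA r).2 fun h => lt_irrefl _ (h _ hr)).and ((hC r).1 fun s hs => ?_)
    exact B.side_zero_lt_side_one hB hr hs
  have h1 : ∀ r : ℝ, (r : Boundary) ∈ B.side 1 → ∀ᶠ n in atTop, C n < r ∧ r < D n := by
    intro r hr
    refine ((hC r).2 fun h => lt_irrefl _ (h _ hr)).and ((hD r).1 fun s hs => ?_)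
    exact B.side_one_lt_side_two hB hr hs
  have h2 : ∀ r : ℝ, (r : Boundary) ∈ B.side 2 → ∀ᶠ n in atTop, D n < r ∧ r < E n := by
    intro r hr
    exact ((hD r).2 fun h => lt_irrefl _ (h _ hr)).and ((hE r).1 ⟨_, hr, le_rfl⟩)
  have hord : ∀ᶠ n in atTop, A n < C n ∧ C n < D n ∧ D n < E n := by
    obtain ⟨s0, hs0⟩ := (B.isArc 0).1
    obtain ⟨s1, hs1⟩ := (B.isArc 1).1
    obtain ⟨s2, hs2⟩ := (B.isArc 2).1
    obtain ⟨r0, rfl⟩ := hreal 0 (by decide) s0 hs0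
    obtain ⟨r1, rfl⟩ := hreal 1 (by decide) s1 hs1
    obtain ⟨r2, rfl⟩ := hreal 2 (by decide) s2 hs2
    filter_upwards [h0 _ hs0, h1 _ hs1, h2 _ hs2] with n i0 i1 i2
    exact ⟨i0.1.trans i0.2, i1.1.trans i1.2, i2.1.trans i2.2⟩
  have hco : ∀ {a b : ℝ}, a < b → cut (a : Boundary) < cut (b : Boundary) :=
    fun h => EReal.coe_lt_coe_iff.2 h
  refine ⟨A, C, D, E, hord, fun t ht => ?_, fun t ht => ?_, fun t ht => ?_, fun t ht => ?_⟩
  · obtain ⟨r, rfl⟩ := hreal 0 (by decide) t ht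
    filter_upwards [h0 r ht] with n hn
    exact Or.inl ⟨hco hn.1, hco hn.2⟩
  · obtain ⟨r, rfl⟩ := hreal 1 (by decide) t ht
    filter_upwards [h1 r ht] with n hn
    exact Or.inl ⟨hco hn.1, hco hn.2⟩
  · obtain ⟨r, rfl⟩ := hreal 2 (by decide) t ht
    filter_upwards [h2 r ht] with n hn
    exact Or.inl ⟨hco hn.1, hco hn.2⟩
  · induction t using OnePoint.rec with
    | infty =>
      filter_upwards [hord] with n hn
      exact Or.inr (Or.inr ⟨hco (hn.1.trans (hn.2.1.trans hn.2.2)), EReal.coe_lt_top _⟩)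
    | coe r =>
      -- A real point of side 3 is below all of side 0 or above all of side 2; otherwise it would
      -- lie between points of these sides.
      have key : (∀ᶠ n in atTop, r < A n) ∨ (∀ᶠ n in atTop, E n < r) := by
        by_contra hcon
        obtain ⟨i, j⟩ := not_or.1 hcon
        have i' : ∃ s ∈ B.side 0, cut s ≤ r := by
          by_contra h
          refine i ((hA r).1 fun s hs => ?_)
          by_contra h'
          exact h ⟨s, hs, not_lt.1 h'⟩
        have j' : ∃ s ∈ B.side 2, (r : EReal) ≤ cut s := by
          by_contra h
          exact j ((hE r).2 h)
        obtain ⟨s, hs, hsr⟩ := i'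
        obtain ⟨s', hs', hsr'⟩ := j'
        have hne : ∀ u, ∀ k : Fin 4, k ≠ 3 → u ∈ B.side k → cut u ≠ cut (r : Boundary) := by
          intro u k hk hu h
          rw [cut_injective h] at hu
          exact hk (B.eq_of_mem hu ht)
        exact B.side_three_outside hB hs hs' ht
          (lt_of_le_of_ne hsr (hne s 0 (by decide) hs))
          (lt_of_le_of_ne hsr' (hne s' 2 (by decide) hs').symm)
      rcases key with key | key
      · filter_upwards [key, hord] with n hn ho
        exact Or.inr (Or.inl ⟨hco hn, hco (ho.1.trans (ho.2.1.trans ho.2.2))⟩)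
      · filter_upwards [key, hord] with n hn ho
        exact Or.inr (Or.inr ⟨hco (ho.1.trans (ho.2.1.trans ho.2.2)), hco hn⟩)

open Filter in
theorem eventually_mem_geodesicsBetween {I J : Set Boundary} {I' J' : ℕ → Set Boundary}
    (hI : ∀ t ∈ I, ∀ᶠ n in atTop, t ∈ I' n) (hJ : ∀ t ∈ J, ∀ᶠ n in atTop, t ∈ J' n) :
    ∀ γ ∈ geodesicsBetween I J, ∀ᶠ n in atTop, γ ∈ geodesicsBetween (I' n) (J' n) := by
  rintro _ ⟨ξ, hξ, η, hη, h, rfl⟩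
  filter_upwards [hI ξ hξ, hJ η hη] with n h1 h2
  exact ⟨ξ, h1, η, h2, h, rfl⟩

theorem Box.exists_reals_of_infty_mem (m : Measure Geodesic) (B : Box)
    (hB : OnePoint.infty ∈ B.side 3) {r : ℝ≥0∞} (h1 : r < m B.carrier)
    (h2 : r < m B.opposite.carrier) : ∃ A C D E : ℝ, A < C ∧ C < D ∧ D < E ∧
      r < m (geodesicsBetween (openArc A C) (openArc D E)) ∧
      r < m (geodesicsBetween (openArc E A) (openArc C D)) := by
  obtain ⟨A, C, D, E, ho, k0, k1, k2, k3⟩ := B.exists_seq hB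
  have e1 := eventually_lt_measure m (eventually_mem_geodesicsBetween k0 k2) h1
  have e2 := eventually_lt_measure m (eventually_mem_geodesicsBetween k3 k1) h2
  obtain ⟨n, ⟨i1, i2, i3⟩, i4, i5⟩ := (ho.and (e1.and e2)).exists
  exact ⟨A n, C n, D n, E n, i1, i2, i3, i4, i5⟩

theorem Box.opposite_opposite_carrier (B : Box) : B.opposite.opposite.carrier = B.carrier :=
  geodesicsBetween_comm _ _

/-- Passing to the opposite box rotates the sides by one place and exchanges the two measures, so at
most three rotations bring ∞ into the last side without changing the hypothesis. -/
theorem Box.exists_reals (m : Measure Geodesic) (B : Box) {r : ℝ≥0∞}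
    (h : r < min (m B.carrier) (m B.opposite.carrier)) : ∃ A C D E : ℝ, A < C ∧ C < D ∧ D < E ∧
      r < m (geodesicsBetween (openArc A C) (openArc D E)) ∧
      r < m (geodesicsBetween (openArc E A) (openArc C D)) := by
  obtain ⟨h1, h2⟩ := lt_min_iff.1 h
  have h3 : r < m B.opposite.opposite.carrier := by rwa [B.opposite_opposite_carrier]
  have h4 : r < m B.opposite.opposite.opposite.carrier := by
    rwa [B.opposite.opposite_opposite_carrier]
  have h5 : r < m B.opposite.opposite.opposite.opposite.carrier := by
    rwa [B.opposite.opposite.opposite_opposite_carrier]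
  obtain ⟨i, hi, -⟩ := B.partition OnePoint.infty
  fin_cases i
  · exact B.opposite.opposite.opposite.exists_reals_of_infty_mem m hi h4 h5
  · exact B.opposite.opposite.exists_reals_of_infty_mem m hi h3 h4
  · exact B.opposite.exists_reals_of_infty_mem m hi h2 h3
  · exact B.exists_reals_of_infty_mem m hi h1 h2

/-! ### Thin boxes -/

theorem cut_coe_lt {a b : ℝ} (h : a < b) : cut (a : Boundary) < cut (b : Boundary) :=
  EReal.coe_lt_coe_iff.2 h

theorem geodesicsBetween_subset_sepSet {P Q R S : Boundary} (h1 : cut P < cut Q)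
    (h2 : cut Q < cut R) (h3 : cut R < cut S) :
    geodesicsBetween (openArc S P) (openArc Q R) ⊆ sepSet P Q R S := by
  rintro _ ⟨ξ, hξ, η, hη, h, rfl⟩
  rw [mem_openArc_of_gt (h1.trans (h2.trans h3))] at hξ
  rw [mem_openArc_of_lt h2] at hη
  refine ⟨ξ, η, h, rfl, ?_⟩
  simp only [bdEq_mul_bdEq ξ η h]
  have b1 := (bracket_neg_iff η P).2 (h1.trans hη.1)
  have b2 := (bracket_neg_iff η Q).2 hη.1
  have b3 := (bracket_pos_iff η R).2 hη.2
  have b4 := (bracket_pos_iff η S).2 (hη.2.trans h3)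
  rcases hξ with hξ | hξ
  · have a1 := (bracket_pos_iff ξ P).2 hξ
    have a2 := (bracket_pos_iff ξ Q).2 (hξ.trans h1)
    have a3 := (bracket_pos_iff ξ R).2 (hξ.trans (h1.trans h2))
    have a4 := (bracket_pos_iff ξ S).2 (hξ.trans (h1.trans (h2.trans h3)))
    exact ⟨mul_pos (mul_pos a1 a2) (mul_pos_of_neg_of_neg b1 b2),
      mul_neg_of_pos_of_neg (mul_pos a1 a3) (mul_neg_of_neg_of_pos b1 b3),
      mul_pos (mul_pos a3 a4) (mul_pos b3 b4)⟩
  · have a1 := (bracket_neg_iff ξ P).2 ((h1.trans (h2.trans h3)).trans hξ)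
    have a2 := (bracket_neg_iff ξ Q).2 ((h2.trans h3).trans hξ)
    have a3 := (bracket_neg_iff ξ R).2 (h3.trans hξ)
    have a4 := (bracket_neg_iff ξ S).2 hξ
    exact ⟨mul_pos (mul_pos_of_neg_of_neg a1 a2) (mul_pos_of_neg_of_neg b1 b2),
      mul_neg_of_pos_of_neg (mul_pos_of_neg_of_neg a1 a3) (mul_neg_of_neg_of_pos b1 b3),
      mul_pos (mul_pos_of_neg_of_neg a3 a4) (mul_pos b3 b4)⟩

theorem geodesicsBetween_subset_sepSet' {P Q R S : Boundary} (h1 : cut P < cut Q)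
    (h2 : cut Q < cut R) (h3 : cut R < cut S) :
    geodesicsBetween (openArc P Q) (openArc R S) ⊆ sepSet P S Q R := by
  rintro _ ⟨ξ, hξ, η, hη, h, rfl⟩
  rw [mem_openArc_of_lt h1] at hξ
  rw [mem_openArc_of_lt h3] at hη
  refine ⟨ξ, η, h, rfl, ?_⟩
  simp only [bdEq_mul_bdEq ξ η h]
  have a1 := (bracket_neg_iff ξ P).2 hξ.1
  have a2 := (bracket_pos_iff ξ Q).2 hξ.2
  have a3 := (bracket_pos_iff ξ R).2 (hξ.2.trans h2)
  have a4 := (bracket_pos_iff ξ S).2 (hξ.2.trans (h2.trans h3))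
  have b1 := (bracket_neg_iff η P).2 ((h1.trans h2).trans hη.1)
  have b2 := (bracket_neg_iff η Q).2 (h2.trans hη.1)
  have b3 := (bracket_neg_iff η R).2 hη.1
  have b4 := (bracket_pos_iff η S).2 hη.2
  exact ⟨mul_pos_of_neg_of_neg (mul_neg_of_neg_of_pos a1 a4) (mul_neg_of_neg_of_pos b1 b4),
    mul_neg_of_neg_of_pos (mul_neg_of_neg_of_pos a1 a2) (mul_pos_of_neg_of_neg b1 b2),
    mul_pos (mul_pos a2 a3) (mul_pos_of_neg_of_neg b2 b3)⟩

/-- The geodesics separating two pairs of points at infinity cross a segment, of length bounded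
by the cross ratio. -/
theorem exists_seg_of_sepSet {s t u v a b c d N : ℝ} (hst : s ≠ t) (huv : u ≠ v) (ha : 0 < a)
    (hb : 0 < b) (hc : 0 < c) (hd : 0 < d) (hN : 0 < N) (habcd : a * b * (c * d) = N ^ 2)
    (hle : a * c * (s - u) ^ 2 + a * d * (s - v) ^ 2 + b * c * (t - u) ^ 2 + b * d * (t - v) ^ 2
      ≤ 6 * (N * (|s - t| * |u - v|))) :
    ∃ x y : ℍ, dist x y ≤ 5 ∧ sepSet s t u v ⊆ transversal (seg x y \ {y}) := by
  obtain ⟨x, hx1, hx2, hx3⟩ := exists_barycenter hst ha hb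
  obtain ⟨y, hy1, hy2, hy3⟩ := exists_barycenter huv hc hd
  have hab : 0 < a + b := by linarith
  have hcd : 0 < c + d := by linarith
  refine ⟨x, y, ?_, ?_⟩
  · have hcosh : Real.cosh (dist x y) * (x.im * y.im) =
        ((x.re - y.re) ^ 2 + x.im ^ 2 + y.im ^ 2) / 2 := by
      have hx := x.im_pos
      have hy := y.im_pos
      rw [UpperHalfPlane.cosh_dist, Complex.dist_eq, Complex.sq_norm, Complex.normSq_apply]
      simp only [Complex.sub_re, Complex.sub_im, UpperHalfPlane.coe_re, UpperHalfPlane.coe_im]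
      field_simp
      ring
    have him : ((a + b) * x.im) * ((c + d) * y.im) = N * (|s - t| * |u - v|) := by
      have : √(a * b) * √(c * d) = N := by
        rw [← Real.sqrt_mul (mul_pos ha hb).le, habcd, Real.sqrt_sq hN.le]
      rw [hx2, hy2, ← this]
      ring
    have ex : ((a + b) * x.im) ^ 2 = a * b * (s - t) ^ 2 := by
      rw [hx2, mul_pow, Real.sq_sqrt (mul_pos ha hb).le, sq_abs]
    have ey : ((c + d) * y.im) ^ 2 = c * d * (u - v) ^ 2 := by
      rw [hy2, mul_pow, Real.sq_sqrt (mul_pos hc hd).le, sq_abs]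
    have hE : (a + b) * (c + d) * ((x.re - y.re) ^ 2 + x.im ^ 2 + y.im ^ 2) =
        a * c * (s - u) ^ 2 + a * d * (s - v) ^ 2 + b * c * (t - u) ^ 2 + b * d * (t - v) ^ 2 := by
      have e1 : x.re = (a * s + b * t) / (a + b) := by
        rw [eq_div_iff hab.ne']; linarith
      have e2 : y.re = (c * u + d * v) / (c + d) := by
        rw [eq_div_iff hcd.ne']; linarith
      have e3 : x.im ^ 2 = a * b * (s - t) ^ 2 / (a + b) ^ 2 := by
        rw [eq_div_iff (by positivity)]; linarith
      have e4 : y.im ^ 2 = c * d * (u - v) ^ 2 / (c + d) ^ 2 := by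
        rw [eq_div_iff (by positivity)]; linarith
      rw [e1, e2, e3, e4]
      field_simp
      ring
    have hP : 0 < (a + b) * (c + d) * (x.im * y.im) :=
      mul_pos (mul_pos hab hcd) (mul_pos x.im_pos y.im_pos)
    have h3 : Real.cosh (dist x y) ≤ 3 := by
      refine le_of_mul_le_mul_right ?_ hP
      calc Real.cosh (dist x y) * ((a + b) * (c + d) * (x.im * y.im)) =
            (a + b) * (c + d) * (Real.cosh (dist x y) * (x.im * y.im)) := by ring
        _ = ((a + b) * (c + d) * ((x.re - y.re) ^ 2 + x.im ^ 2 + y.im ^ 2)) / 2 := by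
            rw [hcosh]; ring
        _ ≤ 3 * (((a + b) * x.im) * ((c + d) * y.im)) := by rw [hE, him]; linarith
        _ = 3 * ((a + b) * (c + d) * (x.im * y.im)) := by ring
    -- From cosh d ≤ 3 one gets e^d < 6, and d + 1 ≤ e^d then gives d < 5.
    have h4 := Real.add_one_le_exp (dist x y)
    have h5 := Real.exp_pos (-dist x y)
    rw [Real.cosh_eq] at h3
    linarith
  -- The value at x is a positive combination of those at s, t, and the value at y one of those at
  -- u, v; separation gives these two pairs opposite signs.
  · rintro _ ⟨ξ, η, h, rfl, h1, h2, h3⟩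
    rw [mem_transversal_iff]
    left
    have ex := hx3 ξ η h
    have ey := hy3 ξ η h
    have h4 : 0 < bdEq ξ η s * bdEq ξ η s := mul_self_pos.2 (left_ne_zero_of_mul h1.ne')
    have h5 : bdEq ξ η s * bdEq ξ η v < 0 := by
      have i1 := mul_neg_of_neg_of_pos h2 h3
      have i2 : 0 < bdEq ξ η u * bdEq ξ η u := mul_self_pos.2 (left_ne_zero_of_mul h3.ne')
      by_contra i3
      have i4 := mul_nonneg (not_lt.1 i3) i2.le
      linarith
    have i1 : 0 < bdEq ξ η s * lineEq ξ η x := by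
      have : 0 < a * (bdEq ξ η s * bdEq ξ η s) + b * (bdEq ξ η s * bdEq ξ η t) :=
        add_pos (mul_pos ha h4) (mul_pos hb h1)
      refine (mul_pos_iff_of_pos_left hab).1 ?_
      linear_combination this - bdEq ξ η s * ex
    have i2 : bdEq ξ η s * lineEq ξ η y < 0 := by
      have : 0 < c * (-(bdEq ξ η s * bdEq ξ η u)) + d * (-(bdEq ξ η s * bdEq ξ η v)) :=
        add_pos (mul_pos hc (neg_pos.2 h2)) (mul_pos hd (neg_pos.2 h5))
      refine neg_pos.1 ((mul_pos_iff_of_pos_left hcd).1 ?_)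
      linear_combination this + bdEq ξ η s * ey
    have i3 := mul_neg_of_pos_of_neg i1 i2
    by_contra i4
    have i5 := mul_nonneg (not_lt.1 i4) h4.le
    linarith

/-- One of two opposite boxes is crossed by a segment of bounded length. -/
theorem exists_seg_of_box {A B C D : ℝ} (h1 : A < B) (h2 : B < C) (h3 : C < D) :
    ∃ x y : ℍ, dist x y ≤ 5 ∧
      (geodesicsBetween (openArc A B) (openArc C D) ⊆ transversal (seg x y \ {y}) ∨
        geodesicsBetween (openArc D A) (openArc B C) ⊆ transversal (seg x y \ {y})) := by
  have p1 : 0 < B - A := by linarith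
  have p2 : 0 < C - B := by linarith
  have p3 : 0 < D - C := by linarith
  have p4 : 0 < C - A := by linarith
  have p5 : 0 < D - B := by linarith
  have p6 : 0 < D - A := by linarith
  -- Each weight is the product of the differences of the other three points, so the product of all
  -- four is N². With them the four terms of the length estimate agree in pairs, which makes the
  -- points the feet of the common perpendicular. By (C-A)(D-B) = (B-A)(D-C) + (D-A)(C-B), their sum
  -- is 2N times twice one product on the right plus the other; choosing the smaller one to be
  -- doubled gives the factor 6.
  have hα : 0 < (C - B) * (D - C) * (D - B) := by positivity
  have hβ : 0 < (C - A) * (D - C) * (D - A) := by positivity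
  have hγ : 0 < (B - A) * (D - B) * (D - A) := by positivity
  have hδ : 0 < (B - A) * (C - B) * (C - A) := by positivity
  have hN : 0 < (B - A) * (C - B) * (D - C) * (C - A) * (D - B) * (D - A) := by positivity
  rcases le_total ((B - A) * (D - C)) ((D - A) * (C - B)) with h | h
  · obtain ⟨x, y, hd, hs⟩ := exists_seg_of_sepSet (h1.trans (h2.trans h3)).ne h2.ne hα hδ hβ hγ hN
      (by ring) (by
        rw [abs_sub_comm A, abs_sub_comm B, abs_of_pos p6, abs_of_pos p2]
        have := mul_le_mul_of_nonneg_left h hN.le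
        linear_combination 4 * this)
    exact ⟨x, y, hd, Or.inl ((geodesicsBetween_subset_sepSet' (cut_coe_lt h1) (cut_coe_lt h2)
      (cut_coe_lt h3)).trans hs)⟩
  · obtain ⟨x, y, hd, hs⟩ := exists_seg_of_sepSet h1.ne h3.ne hα hβ hγ hδ hN
      (by ring) (by
        rw [abs_sub_comm A, abs_sub_comm C, abs_of_pos p1, abs_of_pos p3]
        have := mul_le_mul_of_nonneg_left h hN.le
        linear_combination 4 * this)
    exact ⟨x, y, hd, Or.inr ((geodesicsBetween_subset_sepSet (cut_coe_lt h1) (cut_coe_lt h2)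
      (cut_coe_lt h3)).trans hs)⟩

/-! ### Finiteness -/

/-- The set of geodesics meeting a compact set has finite measure. -/
theorem measure_meeting_ne_top (m : Measure Geodesic) [IsLocallyFiniteMeasure m] {K : Set ℍ}
    (hK : IsCompact K) : m {γ | ∃ z ∈ K, z ∈ γ.points} ≠ ∞ := by
  rcases K.eq_empty_or_nonempty with rfl | hne
  · simp
  obtain ⟨z₀, -, hz₀⟩ := hK.exists_isMinOn hne UpperHalfPlane.continuous_im.continuousOn
  obtain ⟨M, hM⟩ := hK.exists_bound_of_continuousOn UpperHalfPlane.continuous_re.continuousOn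
  obtain ⟨M', hM'⟩ := hK.exists_bound_of_continuousOn UpperHalfPlane.continuous_im.continuousOn
  set ε : ℝ := z₀.im with hε
  set R : ℝ := M + M' with hR
  have hε0 : 0 < ε := z₀.im_pos
  -- Ordered pairs whose first entry is real and bounded and whose entries are not ε-close. For two
  -- real ends, (re p - a)(re p - b) = -(im p)² puts one end within im p of re p, and keeps the ends
  -- at least im p ≥ ε apart.
  let C : Set (Boundary × Boundary) :=
    (((fun a : ℝ => (a : Boundary)) '' Icc (-R) R) ×ˢ univ) \
      (Prod.map (fun a : ℝ => (a : Boundary)) (fun a : ℝ => (a : Boundary)) ''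
        {p : ℝ × ℝ | |p.1 - p.2| < ε})
  have hC : IsCompact C := by
    refine ((isCompact_Icc.image OnePoint.continuous_coe).prod isCompact_univ).diff ?_
    refine (OnePoint.isOpenEmbedding_coe.prodMap OnePoint.isOpenEmbedding_coe).isOpenMap _ ?_
    exact isOpen_lt (by fun_prop) continuous_const
  have hC' : IsCompact {p : DistinctPair | p.1 ∈ C} := by
    rw [Subtype.isCompact_iff]
    convert hC using 1
    ext p
    constructor
    · rintro ⟨q, hq, rfl⟩
      exact hq
    · intro hp
      refine ⟨⟨p, ?_⟩, hp, rfl⟩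
      intro h12
      obtain ⟨⟨⟨a, -, ha⟩, -⟩, hn⟩ := hp
      refine hn ⟨(a, a), by simpa using hε0, ?_⟩
      exact Prod.ext ha (ha.trans h12)
  have hK' : IsCompact (Quotient.mk flipSetoid '' {p : DistinctPair | p.1 ∈ C} : Set Geodesic) :=
    hC'.image continuous_quotient_mk'
  refine ((measure_mono ?_).trans_lt hK'.measure_lt_top).ne
  intro γ
  induction γ using Quotient.ind with
  | _ p =>
  obtain ⟨⟨ξ, η⟩, h⟩ := p
  rintro ⟨p, hpK, hp0⟩
  have hp0 : lineEq ξ η p = 0 := hp0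
  have him1 : ε ≤ p.im := hz₀ hpK
  have hpi := p.im_pos
  have him2 : p.im ≤ M' := by
    have := hM' p hpK
    rwa [Real.norm_of_nonneg hpi.le] at this
  have hre' := abs_le.1 (hM p hpK)
  have hvert : ∀ a : ℝ, p.re - a = 0 → ((a : Boundary), (OnePoint.infty : Boundary)) ∈ C := by
    intro a ha
    refine ⟨⟨⟨a, ⟨by linarith, by linarith⟩, rfl⟩, mem_univ _⟩, ?_⟩
    rintro ⟨⟨b, c⟩, -, hbc⟩
    exact OnePoint.coe_ne_infty c (congrArg Prod.snd hbc)
  have hcirc : ∀ a b : ℝ, (p.re - a) * (p.re - b) + p.im ^ 2 = 0 → |p.re - a| ≤ p.im →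
      ((a : Boundary), (b : Boundary)) ∈ C := by
    intro a b hab ha
    have ha' := abs_le.1 ha
    refine ⟨⟨⟨a, ⟨by linarith, by linarith⟩, rfl⟩, mem_univ _⟩, ?_⟩
    rintro ⟨⟨a', b'⟩, hlt, hbc⟩
    obtain rfl : a' = a := OnePoint.coe_injective (congrArg Prod.fst hbc)
    obtain rfl : b' = b := OnePoint.coe_injective (congrArg Prod.snd hbc)
    have hlt : |a' - b'| < ε := hlt
    have : |a' - b'| < p.im := hlt.trans_le him1
    have h1 : (a' - b') ^ 2 < p.im ^ 2 := sq_lt_sq.2 (by rwa [abs_of_pos hpi])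
    nlinarith [sq_nonneg (p.re - a'), sq_nonneg (p.re - b')]
  have hor : (ξ, η) ∈ C ∨ (η, ξ) ∈ C := by
    induction ξ using OnePoint.rec with
    | infty =>
      induction η using OnePoint.rec with
      | infty => exact absurd rfl h
      | coe b => exact Or.inr (hvert b (by simpa [lineEq] using hp0))
    | coe a =>
      induction η using OnePoint.rec with
      | infty => exact Or.inl (hvert a (by simpa [lineEq] using hp0))
      | coe b =>
        have hp0 : (p.re - a) * (p.re - b) + p.im ^ 2 = 0 := by simpa [lineEq] using hp0
        by_cases ha : |p.re - a| ≤ p.im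
        · exact Or.inl (hcirc a b hp0 ha)
        · refine Or.inr (hcirc b a (by linarith) ?_)
          by_contra hb
          have h1 := mul_lt_mul'' (not_le.1 ha) (not_le.1 hb) hpi.le hpi.le
          rw [← abs_mul, show (p.re - a) * (p.re - b) = -p.im ^ 2 by linarith, abs_neg,
            abs_of_nonneg (sq_nonneg _)] at h1
          linarith
  rcases hor with h' | h'
  · exact ⟨⟨(ξ, η), h⟩, h', rfl⟩
  · exact ⟨⟨(η, ξ), h.symm⟩, h', Quotient.sound (Or.inr rfl)⟩

/-! ### Equivariance and cocompactness -/

/-- Homogeneous coordinates of a point at infinity. -/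
noncomputable def homog (ξ : Boundary) : ℝ × ℝ := ξ.elim (1, 0) (fun a => (a, 1))

/-- In homogeneous coordinates the equation has one form for real endpoints and for ∞. It says that
s₂z - s₁ and t₂z - t₁ are orthogonal as vectors of ℂ. -/
theorem lineEq_eq_zero_iff {ξ η : Boundary} (h : ξ ≠ η) (z : ℍ) : lineEq ξ η z = 0 ↔
    ((homog ξ).2 * z.re - (homog ξ).1) * ((homog η).2 * z.re - (homog η).1) +
      (homog ξ).2 * (homog η).2 * z.im ^ 2 = 0 := by
  induction ξ using OnePoint.rec with
  | infty =>
    induction η using OnePoint.rec with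
    | infty => exact absurd rfl h
    | coe b => simp [lineEq, homog]; grind
  | coe a =>
    induction η using OnePoint.rec with
    | infty => simp [lineEq, homog]; grind
    | coe b => simp [lineEq, homog]

theorem homog_bdAct (g : SL(2, ℝ)) (ξ : Boundary) : ∃ l : ℝ, l ≠ 0 ∧
    l * (homog (bdAct g ξ)).1 = g 0 0 * (homog ξ).1 + g 0 1 * (homog ξ).2 ∧
    l * (homog (bdAct g ξ)).2 = g 1 0 * (homog ξ).1 + g 1 1 * (homog ξ).2 := by
  have hdet : g 0 0 * g 1 1 - g 0 1 * g 1 0 = 1 := by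
    rw [← Matrix.det_fin_two]; exact g.det_coe
  induction ξ using OnePoint.rec with
  | infty =>
    simp only [bdAct, OnePoint.smul_infty_eq_ite]
    by_cases h : g 1 0 = 0
    · refine ⟨g 0 0, ?_, ?_⟩
      · intro h0; rw [h, h0] at hdet; simp at hdet
      · simp [homog, h]
    · refine ⟨g 1 0, h, ?_⟩
      simp [homog, h]
      field_simp
  | coe a =>
    simp only [bdAct, OnePoint.smul_some_eq_ite]
    by_cases h : g 1 0 * a + g 1 1 = 0
    · refine ⟨g 0 0 * a + g 0 1, ?_, ?_⟩
      · intro h0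
        have : g 0 0 * g 1 1 - g 0 1 * g 1 0 = 0 := by
          linear_combination g 0 0 * h - g 1 0 * h0
        linarith
      · simp [homog, h]
    · refine ⟨g 1 0 * a + g 1 1, h, ?_⟩
      simp [homog, h]
      field_simp

/-- These are the real and imaginary parts of (cz + d)(g • z) = az + b, free of denominators. -/
theorem smul_re_im (g : SL(2, ℝ)) (z : ℍ) :
    (g 1 0 * z.re + g 1 1) * (g • z).re - g 1 0 * z.im * (g • z).im = g 0 0 * z.re + g 0 1 ∧
    g 1 0 * z.im * (g • z).re + (g 1 0 * z.re + g 1 1) * (g • z).im = g 0 0 * z.im := by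
  have h := UpperHalfPlane.coe_specialLinearGroup_apply g z
  have hne : ((g 1 0 : ℝ) : ℂ) * z + (g 1 1 : ℝ) ≠ 0 := by
    intro h0
    have h1 := congrArg Complex.im h0
    have h2 := congrArg Complex.re h0
    simp at h1 h2
    have hdet : g 0 0 * g 1 1 - g 0 1 * g 1 0 = 1 := by
      rw [← Matrix.det_fin_two]; exact g.det_coe
    have h3 : g 1 0 = 0 := h1.resolve_right z.im_pos.ne'
    rw [h3] at h2 hdet
    simp at h2
    rw [h2] at hdet
    simp at hdet
  rw [eq_div_iff (by exact hne)] at h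
  have h1 := congrArg Complex.re h
  have h2 := congrArg Complex.im h
  simp at h1 h2
  constructor <;> linarith

/-- Both vectors in the orthogonality relation of `lineEq_eq_zero_iff` transform by the same complex
factor cz + d, up to non-zero real scalars, and such a change preserves orthogonality. -/
theorem smul_mem_points_act (g : SL(2, ℝ)) (γ : Geodesic) (z : ℍ) (hz : z ∈ γ.points) :
    g • z ∈ (Geodesic.act g γ).points := by
  induction γ using Quotient.ind with
  | _ p =>
  obtain ⟨⟨ξ, η⟩, h⟩ := p
  have hz : lineEq ξ η z = 0 := hz
  have h' : bdAct g ξ ≠ bdAct g η := fun e => h (MulAction.injective (g : GL (Fin 2) ℝ) e)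
  change lineEq (bdAct g ξ) (bdAct g η) (g • z) = 0
  rw [lineEq_eq_zero_iff h] at hz
  rw [lineEq_eq_zero_iff h']
  have hdet : g 0 0 * g 1 1 - g 0 1 * g 1 0 = 1 := by
    rw [← Matrix.det_fin_two]; exact g.det_coe
  obtain ⟨l, hl, hl1, hl2⟩ := homog_bdAct g ξ
  obtain ⟨k, hk, hk1, hk2⟩ := homog_bdAct g η
  obtain ⟨r1, r2⟩ := smul_re_im g z
  have hv := z.im_pos
  generalize (g • z).re = p at *
  generalize (g • z).im = q at *
  generalize z.re = u at *
  generalize z.im = v at *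
  generalize (homog ξ) = s at *
  generalize (homog η) = t at *
  generalize (homog (bdAct g ξ)) = s' at *
  generalize (homog (bdAct g η)) = t' at *
  generalize g 0 0 = a at *
  generalize g 0 1 = b at *
  generalize g 1 0 = c at *
  generalize g 1 1 = d at *
  -- This is (cz + d) · e (y₂ (g • z) - y₁) = x₂z - x₁, split into real and imaginary parts; it uses
  -- that the determinant is 1.
  have key : ∀ (x y : ℝ × ℝ) (e : ℝ), e * y.1 = a * x.1 + b * x.2 → e * y.2 = c * x.1 + d * x.2 →
      (c * u + d) * (e * (y.2 * p - y.1)) - c * v * (e * (y.2 * q)) = x.2 * u - x.1 ∧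
      (c * u + d) * (e * (y.2 * q)) + c * v * (e * (y.2 * p - y.1)) = x.2 * v := by
    intro x y e e1 e2
    constructor
    · linear_combination (e * y.2) * r1 + (a * u + b) * e2 - (c * u + d) * e1 +
        (x.2 * u - x.1) * hdet
    · linear_combination (e * y.2) * r2 + (a * v) * e2 - c * v * e1 + x.2 * v * hdet
  obtain ⟨i1, i2⟩ := key s s' l hl1 hl2
  obtain ⟨j1, j2⟩ := key t t' k hk1 hk2
  have hM : ((c * u + d) ^ 2 + (c * v) ^ 2) ≠ 0 := by
    intro h0
    have h1 : c * v = 0 := by nlinarith [sq_nonneg (c * u + d), sq_nonneg (c * v)]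
    have h2 : c = 0 := (mul_eq_zero.1 h1).resolve_right hv.ne'
    rw [h2] at h0 hdet
    have h3 : d = 0 := by
      have : d ^ 2 = 0 := by linarith
      exact pow_eq_zero_iff two_ne_zero |>.1 this
    rw [h3] at hdet
    simp at hdet
  refine (mul_eq_zero.1 (?_ : (((c * u + d) ^ 2 + (c * v) ^ 2) * (l * k)) * _ = 0)).resolve_left
    (mul_ne_zero hM (mul_ne_zero hl hk))
  have hz' : (s.2 * u - s.1) * (t.2 * u - t.1) + (s.2 * v) * (t.2 * v) = 0 := by linarith
  rw [← i1, ← i2, ← j1, ← j2] at hz'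
  linear_combination hz'

/-- The images of the balls around `UpperHalfPlane.I` form an increasing open cover of the compact
quotient, so a single ball already surjects onto it. -/
theorem exists_radius {Γ : Subgroup SL(2, ℝ)} (hΓ : IsClosedSurfaceGroup Γ) :
    ∃ R : ℝ, ∀ x : ℍ, ∃ g ∈ Γ, dist (g • x) UpperHalfPlane.I ≤ R := by
  have := hΓ.compact
  let π : ℍ → MulAction.orbitRel.Quotient Γ ℍ := Quotient.mk _
  have hπ : IsOpenMap π := isOpenMap_quotient_mk'_mul
  obtain ⟨n, hn⟩ := isCompact_univ.elim_directed_cover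
    (fun n : ℕ => π '' Metric.ball UpperHalfPlane.I n) (fun n => hπ _ Metric.isOpen_ball)
    (by
      intro q _
      induction q using Quotient.ind with
      | _ x =>
      obtain ⟨n, hn⟩ := exists_nat_gt (dist x UpperHalfPlane.I)
      exact mem_iUnion.2 ⟨n, x, hn, rfl⟩)
    (directed_of_isDirected_le fun n k h => image_mono (Metric.ball_subset_ball (by exact_mod_cast h)))
  refine ⟨n, fun x => ?_⟩
  obtain ⟨y, hy, hyx⟩ := hn (mem_univ (π x))
  obtain ⟨g, hg⟩ := MulAction.orbitRel_apply.1 (Quotient.exact hyx)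
  refine ⟨g, g.2, ?_⟩
  have hg : (g : SL(2, ℝ)) • x = y := hg
  rw [hg]
  exact (Metric.mem_ball.1 hy).le

/-- The geodesics crossing segments of bounded length have bounded measure. -/
theorem exists_bound_transversal {Γ : Subgroup SL(2, ℝ)} (hΓ : IsClosedSurfaceGroup Γ)
    (μ : GeodesicCurrent Γ) (d : ℝ) : ∃ C : ℝ≥0∞, C ≠ ∞ ∧ ∀ x y : ℍ, dist x y ≤ d →
      μ.measure (transversal (seg x y \ {y})) ≤ C := by
  have := μ.locallyFinite
  obtain ⟨R, hR⟩ := exists_radius hΓ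
  refine ⟨_, measure_meeting_ne_top μ.measure (isCompact_closedBall UpperHalfPlane.I (d + R)),
    fun x y hxy => ?_⟩
  obtain ⟨g, hg, hgx⟩ := hR x
  -- Invariance is available for measurable sets only, so the set of geodesics meeting the ball is
  -- replaced by its measurable hull of equal measure.
  rw [← measure_toMeasurable {γ : Geodesic | _}, ← μ.invariant g hg _ (measurableSet_toMeasurable _ _)]
  refine measure_mono fun γ hγ => subset_toMeasurable _ _ ?_
  obtain ⟨p, hp⟩ := hγ
  obtain ⟨hp0, hp1, -⟩ : p ∈ γ.points ∩ (seg x y \ {y}) := by rw [hp]; rfl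
  refine ⟨g • p, ?_, smul_mem_points_act g γ p hp0⟩
  have hp1 : dist x p + dist p y = dist x y := hp1
  have h1 : dist (g • p) (g • x) = dist p x := dist_smul g p x
  rw [Metric.mem_closedBall]
  have h2 := dist_triangle (g • p) (g • x) UpperHalfPlane.I
  have h3 := dist_nonneg (x := p) (y := y)
  rw [dist_comm p x] at h1
  linarith

theorem hypConst_ne_top {Γ : Subgroup SL(2, ℝ)} (hΓ : IsClosedSurfaceGroup Γ)
    (μ : GeodesicCurrent Γ) : hypConst μ ≠ ∞ := by
  obtain ⟨C, hC, hbound⟩ := exists_bound_transversal hΓ μ 5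
  refine ne_top_of_le_ne_top hC (iSup_le fun B => le_of_forall_lt fun r hr => ?_)
  obtain ⟨a, b, c, d, h1, h2, h3, h4, h5⟩ := B.exists_reals μ.measure hr
  obtain ⟨x, y, hxy, h⟩ := exists_seg_of_box h1 h2 h3
  rcases h with h | h
  · exact h4.trans_le ((measure_mono h).trans (hbound x y hxy))
  · exact h5.trans_le ((measure_mono h).trans (hbound x y hxy))

/-! ### Optimality -/

/-- The linear relation between the equations of a geodesic at four points at infinity. -/
theorem bdEq_relation (A B C D : ℝ) (ξ η : Boundary) (h : ξ ≠ η) :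
    (C - B) * (D - C) * (D - B) * bdEq ξ η A + (B - A) * (D - B) * (D - A) * bdEq ξ η C =
      (C - A) * (D - C) * (D - A) * bdEq ξ η B + (B - A) * (C - B) * (C - A) * bdEq ξ η D := by
  induction ξ using OnePoint.rec with
  | infty =>
    induction η using OnePoint.rec with
    | infty => exact absurd rfl h
    | coe b => simp only [bdEq, OnePoint.elim_some, OnePoint.elim_infty]; ring
  | coe a =>
    induction η using OnePoint.rec with
    | infty => simp only [bdEq, OnePoint.elim_some, OnePoint.elim_infty]; ring
    | coe b => simp only [bdEq, OnePoint.elim_some]; ring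

/-- No geodesic separates the ends of a segment from the ends of a segment crossing it. -/
theorem not_weakSep_of_relation {x y z w : ℍ} {ξ η : Boundary} {a b c d : ℝ} (ha : 0 < a)
    (hb : 0 < b) (hc : 0 < c) (hd : 0 < d)
    (h : a * lineEq ξ η x + b * lineEq ξ η z = c * lineEq ξ η y + d * lineEq ξ η w) :
    ¬ WeakSep x z y w ξ η := by
  rw [WeakSep, cutSigns_sign]
  generalize lineEq ξ η x = p at *
  generalize lineEq ξ η y = q at *
  generalize lineEq ξ η z = r at *
  generalize lineEq ξ η w = s at *
  rintro (⟨i, j, k, l⟩ | ⟨i, j, k, l⟩ | ⟨i, j, k, l⟩ | ⟨i, j, k, l⟩)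
  · linarith [mul_pos ha i, mul_pos hb j, mul_nonpos_of_nonneg_of_nonpos hc.le k,
      mul_nonpos_of_nonneg_of_nonpos hd.le l]
  · linarith [mul_nonneg ha.le i, mul_nonneg hb.le j, mul_neg_of_pos_of_neg hc k,
      mul_neg_of_pos_of_neg hd l]
  · linarith [mul_neg_of_pos_of_neg ha i, mul_neg_of_pos_of_neg hb j, mul_nonneg hc.le k,
      mul_nonneg hd.le l]
  · linarith [mul_nonpos_of_nonneg_of_nonpos ha.le i, mul_nonpos_of_nonneg_of_nonpos hb.le j,
      mul_pos hc k, mul_pos hd l]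

theorem mul_neg_of_same_sign {f g f' g' : ℝ} (h : f * g < 0) (hf : 0 < f * f') (hg : 0 < g * g') :
    f' * g' < 0 := by
  have h1 : 0 < (f * g) * (f' * g') := by
    have := mul_pos hf hg
    linarith
  exact neg_of_mul_pos_right h1 h.le

open Filter in
/-- Points converging to points at infinity are eventually on the same sides of a geodesic. -/
theorem eventually_same_sign {ε : ℕ → ℝ} (hε : Tendsto ε atTop (nhds 0)) (hpos : ∀ n, 0 < ε n)
    {f g : ℝ} {e : ℕ → ℝ} (he : ∀ n, (1 + ε n) * e n = 1 * f + ε n * g) (hf : f ≠ 0) :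
    ∀ᶠ n in atTop, 0 < f * e n := by
  have h1 : Tendsto (fun n => f * (f + ε n * g)) atTop (nhds (f * (f + 0 * g))) :=
    ((hε.mul_const g).const_add f).const_mul f
  rw [zero_mul, add_zero] at h1
  filter_upwards [h1.eventually_const_lt (mul_self_pos.2 hf)] with n hn
  have h2 := hpos n
  refine (mul_pos_iff_of_pos_left (show 0 < 1 + ε n by linarith)).1 ?_
  have h3 : (1 + ε n) * (f * e n) = f * (f + ε n * g) := by linear_combination f * he n
  rw [h3]
  exact hn

open Filter in
/-- Four points of the hyperbolic plane nearly realizing the measures of a box and of its opposite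
box in the four-point inequality. -/
theorem exists_four_points (m : Measure Geodesic) {A B C D : ℝ} (h1 : A < B) (h2 : B < C)
    (h3 : C < D) {r : ℝ≥0∞} (hr1 : r < m (geodesicsBetween (openArc A B) (openArc C D)))
    (hr2 : r < m (geodesicsBetween (openArc D A) (openArc B C))) :
    ∃ x y z w : ℍ, edistCurrent m x y + edistCurrent m z w + 2 * r ≤
        edistCurrent m x z + edistCurrent m y w ∧
      edistCurrent m y z + edistCurrent m x w + 2 * r ≤
        edistCurrent m x z + edistCurrent m y w := by
  let ε : ℕ → ℝ := fun n => 1 / ((n : ℝ) + 1)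
  have hε : Tendsto ε atTop (nhds 0) := tendsto_one_div_add_atTop_nhds_zero_nat
  have hpos : ∀ n, 0 < ε n := fun n => Nat.one_div_pos_of_nat
  -- The weights 1 : ε put x near A and z near C on the line AC, and y near B and w near D on the
  -- line BD.
  choose x hx1 hx2 hx using fun n => exists_barycenter (h1.trans h2).ne one_pos (hpos n)
  choose y hy1 hy2 hy using fun n => exists_barycenter (h2.trans h3).ne one_pos (hpos n)
  choose z hz1 hz2 hz using fun n => exists_barycenter (h1.trans h2).ne' one_pos (hpos n)
  choose w hw1 hw2 hw using fun n => exists_barycenter (h2.trans h3).ne' one_pos (hpos n)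
  have p1 : 0 < B - A := by linarith
  have p2 : 0 < C - B := by linarith
  have p3 : 0 < D - C := by linarith
  have p4 : 0 < C - A := by linarith
  have p5 : 0 < D - B := by linarith
  have p6 : 0 < D - A := by linarith
  obtain ⟨α, hα'⟩ : ∃ α, α = (C - B) * (D - C) * (D - B) := ⟨_, rfl⟩
  obtain ⟨β, hβ'⟩ : ∃ β, β = (C - A) * (D - C) * (D - A) := ⟨_, rfl⟩
  obtain ⟨γ, hγ'⟩ : ∃ γ, γ = (B - A) * (D - B) * (D - A) := ⟨_, rfl⟩
  obtain ⟨δ, hδ'⟩ : ∃ δ, δ = (B - A) * (C - B) * (C - A) := ⟨_, rfl⟩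
  have hα : 0 < α := by rw [hα']; positivity
  have hβ : 0 < β := by rw [hβ']; positivity
  have hγ : 0 < γ := by rw [hγ']; positivity
  have hδ : 0 < δ := by rw [hδ']; positivity
  have hsmall : ∀ a b : ℝ, 0 < a → ∀ᶠ n in atTop, 0 < a - b * ε n := by
    intro a b ha
    have : Tendsto (fun n => a - b * ε n) atTop (nhds (a - b * 0)) :=
      (hε.const_mul b).const_sub a
    rw [mul_zero, sub_zero] at this
    exact this.eventually_const_lt ha
  -- The relation `bdEq_relation` at the ends is carried over to the four points by inverting the
  -- barycentric formulas. Its coefficients are positive for small ε, which expresses that the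
  -- segments from x to z and from y to w cross.
  have hrel : ∀ n ξ η, ξ ≠ η → (α - γ * ε n) * lineEq ξ η (x n) + (γ - α * ε n) * lineEq ξ η (z n) =
      (β - δ * ε n) * lineEq ξ η (y n) + (δ - β * ε n) * lineEq ξ η (w n) := by
    intro n ξ η hne
    have e := bdEq_relation A B C D ξ η hne
    rw [← hα', ← hβ', ← hγ', ← hδ'] at e
    have hne0 : 1 + ε n ≠ 0 := by linarith [hpos n]
    refine mul_left_cancel₀ hne0 ?_
    linear_combination (α - γ * ε n) * hx n ξ η hne + (γ - α * ε n) * hz n ξ η hne -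
      (β - δ * ε n) * hy n ξ η hne - (δ - β * ε n) * hw n ξ η hne + (1 - ε n ^ 2) * e
  -- `S₁` consists of the geodesics separating {x,w} from {y,z}, and `S₂` of those separating {x,y}
  -- from {z,w}. In the limit they exhaust the two opposite boxes.
  let S₁ : ℕ → Set Geodesic := fun n => {g | ∃ ξ η, ∃ h : ξ ≠ η, g = Geodesic.mk ξ η h ∧
    lineEq ξ η (x n) * lineEq ξ η (z n) < 0 ∧ lineEq ξ η (x n) * lineEq ξ η (y n) < 0 ∧
    lineEq ξ η (w n) * lineEq ξ η (z n) < 0}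
  let S₂ : ℕ → Set Geodesic := fun n => {g | ∃ ξ η, ∃ h : ξ ≠ η, g = Geodesic.mk ξ η h ∧
    lineEq ξ η (x n) * lineEq ξ η (z n) < 0 ∧ lineEq ξ η (x n) * lineEq ξ η (w n) < 0 ∧
    lineEq ξ η (y n) * lineEq ξ η (z n) < 0}
  have hneg : ∀ {a b c d : ℝ}, 0 < a * b → a * c < 0 → 0 < c * d → a * d < 0 ∧ b * c < 0 := by
    intro a b c d i j k
    have hc : 0 < c * c := mul_self_pos.2 (left_ne_zero_of_mul k.ne')
    have ha : 0 < a * a := mul_self_pos.2 (left_ne_zero_of_mul i.ne')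
    exact ⟨mul_neg_of_same_sign j ha k, mul_neg_of_same_sign j i hc⟩
  have hS₁ : ∀ g ∈ geodesicsBetween (openArc A B) (openArc C D), ∀ᶠ n in atTop, g ∈ S₁ n := by
    intro g hg
    obtain ⟨ξ, η, h, rfl, i, j, k⟩ := geodesicsBetween_subset_sepSet' (cut_coe_lt h1)
      (cut_coe_lt h2) (cut_coe_lt h3) hg
    filter_upwards [
      eventually_same_sign hε hpos (fun n => hx n ξ η h) (left_ne_zero_of_mul i.ne'),
      eventually_same_sign hε hpos (fun n => hy n ξ η h) (left_ne_zero_of_mul k.ne'),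
      eventually_same_sign hε hpos (fun n => hz n ξ η h) (right_ne_zero_of_mul k.ne'),
      eventually_same_sign hε hpos (fun n => hw n ξ η h) (right_ne_zero_of_mul i.ne')]
      with n kx ky kz kw
    have ij := hneg i j k
    refine ⟨ξ, η, h, rfl, mul_neg_of_same_sign ij.1 kx kz, mul_neg_of_same_sign j kx ky, ?_⟩
    exact mul_neg_of_same_sign (hneg (by rwa [mul_comm]) ij.2 k).1 kw kz
  have hS₂ : ∀ g ∈ geodesicsBetween (openArc D A) (openArc B C), ∀ᶠ n in atTop, g ∈ S₂ n := by
    intro g hg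
    obtain ⟨ξ, η, h, rfl, i, j, k⟩ := geodesicsBetween_subset_sepSet (cut_coe_lt h1)
      (cut_coe_lt h2) (cut_coe_lt h3) hg
    filter_upwards [
      eventually_same_sign hε hpos (fun n => hx n ξ η h) (left_ne_zero_of_mul i.ne'),
      eventually_same_sign hε hpos (fun n => hy n ξ η h) (right_ne_zero_of_mul i.ne'),
      eventually_same_sign hε hpos (fun n => hz n ξ η h) (left_ne_zero_of_mul k.ne'),
      eventually_same_sign hε hpos (fun n => hw n ξ η h) (right_ne_zero_of_mul k.ne')]
      with n kx ky kz kw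
    have ij := hneg i j k
    exact ⟨ξ, η, h, rfl, mul_neg_of_same_sign j kx kz, mul_neg_of_same_sign ij.1 kx kw,
      mul_neg_of_same_sign ij.2 ky kz⟩
  obtain ⟨n, a1, a2, a3, a4, m1, m2⟩ := ((hsmall α γ hα).and ((hsmall γ α hγ).and
    ((hsmall β δ hβ).and ((hsmall δ β hδ).and ((eventually_lt_measure m hS₁ hr1).and
      (eventually_lt_measure m hS₂ hr2)))))).exists
  refine ⟨x n, y n, z n, w n, ?_, ?_⟩
  · refine (add_le_add le_rfl (mul_le_mul_right m2.le 2)).trans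
      (add_le_edistCurrent_add m (x n) (y n) (z n) (w n) (S₂ n) (fun ξ η h => ?_) fun g hg => hg)
    exact not_weakSep_of_relation a1 a2 a3 a4 (hrel n ξ η h)
  · have := add_le_edistCurrent_add m (x n) (w n) (z n) (y n) (S₁ n) (fun ξ η h =>
      not_weakSep_of_relation a1 a2 a4 a3 ((hrel n ξ η h).trans (add_comm _ _))) fun g hg => hg
    rw [edistCurrent_comm m (z n) (y n), edistCurrent_comm m (w n) (y n),
      add_comm (edistCurrent m (x n) (w n))] at this
    exact (add_le_add le_rfl (mul_le_mul_right m1.le 2)).trans this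

/-! ### From extended distances on the half-plane to the dual space -/

theorem IsGromovHyperbolic.nonneg {Γ : Subgroup SL(2, ℝ)} {μ : GeodesicCurrent Γ} {δ : ℝ}
    (hδ : IsGromovHyperbolic (DualSpace μ) δ) : 0 ≤ δ := by
  let p : DualSpace μ := SeparationQuotient.mk ⟨UpperHalfPlane.I⟩
  have h := (hδ p p p p).1
  simp only [dist_self, add_zero, max_self, zero_add] at h
  linarith

theorem dist_mk_mk {Γ : Subgroup SL(2, ℝ)} (μ : GeodesicCurrent Γ) (x y : PreDual μ) :
    dist (SeparationQuotient.mk x : DualSpace μ) (SeparationQuotient.mk y) =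
      (edistCurrent μ.measure x.point y.point).toReal :=
  SeparationQuotient.dist_mk x y

theorem toReal_edistCurrent_four_point {Γ : Subgroup SL(2, ℝ)} (μ : GeodesicCurrent Γ)
    (hμ : hypConst μ ≠ ∞) (x y z w : ℍ) :
    (edistCurrent μ.measure x y).toReal + (edistCurrent μ.measure z w).toReal ≤
      max ((edistCurrent μ.measure x z).toReal + (edistCurrent μ.measure y w).toReal)
        ((edistCurrent μ.measure y z).toReal + (edistCurrent μ.measure x w).toReal) +
        2 * (hypConst μ).toReal := by
  have := μ.locallyFinite
  have hf := edistCurrent_ne_top μ.measure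
  have hadd : ∀ p q p' q', edistCurrent μ.measure p q + edistCurrent μ.measure p' q' ≠ ∞ :=
    fun p q p' q' => ENNReal.add_ne_top.2 ⟨hf p q, hf p' q'⟩
  have h2 : 2 * hypConst μ ≠ ∞ := ENNReal.mul_ne_top ENNReal.ofNat_ne_top hμ
  have hmax := max_ne_top (hadd x z y w) (hadd y z x w)
  have h := ENNReal.toReal_mono (ENNReal.add_ne_top.2 ⟨hmax, h2⟩)
    (edistCurrent_four_point μ x y z w)
  rwa [ENNReal.toReal_add hmax h2, ENNReal.toReal_max (hadd _ _ _ _) (hadd _ _ _ _),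
    ENNReal.toReal_add (hf _ _) (hf _ _), ENNReal.toReal_add (hf _ _) (hf _ _),
    ENNReal.toReal_add (hf _ _) (hf _ _), ENNReal.toReal_mul, ENNReal.toReal_ofNat] at h

theorem isGromovHyperbolic_hypConst {Γ : Subgroup SL(2, ℝ)} (μ : GeodesicCurrent Γ)
    (hμ : hypConst μ ≠ ∞) : IsGromovHyperbolic (DualSpace μ) (hypConst μ).toReal := by
  intro x y z w
  obtain ⟨x, rfl⟩ := SeparationQuotient.surjective_mk x
  obtain ⟨y, rfl⟩ := SeparationQuotient.surjective_mk y
  obtain ⟨z, rfl⟩ := SeparationQuotient.surjective_mk z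
  obtain ⟨w, rfl⟩ := SeparationQuotient.surjective_mk w
  simp only [dist_mk_mk]
  refine ⟨toReal_edistCurrent_four_point μ hμ _ _ _ _, ?_, ?_⟩
  · have := toReal_edistCurrent_four_point μ hμ x.point z.point y.point w.point
    rwa [edistCurrent_comm _ z.point y.point] at this
  · have := toReal_edistCurrent_four_point μ hμ y.point z.point x.point w.point
    rwa [edistCurrent_comm _ y.point x.point, edistCurrent_comm _ z.point x.point] at this

/-- Every r below the minimum for some box yields four points whose middle sum exceeds both others
by 2r, so r ≤ δ by the second clause of the four-point condition. -/
theorem hypConst_le_of_isGromovHyperbolic {Γ : Subgroup SL(2, ℝ)} (μ : GeodesicCurrent Γ) {δ : ℝ}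
    (hδ : IsGromovHyperbolic (DualSpace μ) δ) : hypConst μ ≤ ENNReal.ofReal δ := by
  have := μ.locallyFinite
  have hf := edistCurrent_ne_top μ.measure
  refine iSup_le fun B => le_of_forall_lt_imp_le_of_dense fun r hr => ?_
  obtain ⟨a, b, c, d, h1, h2, h3, hr1, hr2⟩ := B.exists_reals μ.measure hr
  obtain ⟨x, y, z, w, k1, k2⟩ := exists_four_points μ.measure h1 h2 h3 hr1 hr2
  have hrt : r ≠ ∞ := hr1.ne_top
  have h2r : 2 * r ≠ ∞ := ENNReal.mul_ne_top ENNReal.ofNat_ne_top hrt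
  have hadd : ∀ p q p' q', edistCurrent μ.measure p q + edistCurrent μ.measure p' q' ≠ ∞ :=
    fun p q p' q' => ENNReal.add_ne_top.2 ⟨hf p q, hf p' q'⟩
  have k1' := ENNReal.toReal_mono (hadd _ _ _ _) k1
  have k2' := ENNReal.toReal_mono (hadd _ _ _ _) k2
  rw [ENNReal.toReal_add (hadd _ _ _ _) h2r, ENNReal.toReal_add (hf _ _) (hf _ _),
    ENNReal.toReal_add (hf _ _) (hf _ _), ENNReal.toReal_mul, ENNReal.toReal_ofNat] at k1' k2'
  have h := (hδ (SeparationQuotient.mk ⟨x⟩) (SeparationQuotient.mk ⟨y⟩) (SeparationQuotient.mk ⟨z⟩)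
    (SeparationQuotient.mk ⟨w⟩)).2.1
  simp only [dist_mk_mk] at h
  refine (ENNReal.le_ofReal_iff_toReal_le hrt ?_).2 ?_
  · exact hδ.nonneg
  · rcases max_choice ((edistCurrent μ.measure x y).toReal + (edistCurrent μ.measure z w).toReal)
      ((edistCurrent μ.measure y z).toReal + (edistCurrent μ.measure x w).toReal) with e | e
    · rw [e] at h; linarith
    · rw [e] at h; linarith

end GeodesicCurrents

theorem theorem6 (Γ : Subgroup SL(2, ℝ)) (hΓ : GeodesicCurrents.IsClosedSurfaceGroup Γ)
    (μ : GeodesicCurrents.GeodesicCurrent Γ) :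
    GeodesicCurrents.hypConst μ ≠ ∞ ∧
      IsLeast {δ : ℝ | GeodesicCurrents.IsGromovHyperbolic (GeodesicCurrents.DualSpace μ) δ}
        (GeodesicCurrents.hypConst μ).toReal := by
  have hμ := GeodesicCurrents.hypConst_ne_top hΓ μ
  refine ⟨hμ, GeodesicCurrents.isGromovHyperbolic_hypConst μ hμ, fun δ hδ => ?_⟩
  have h := GeodesicCurrents.hypConst_le_of_isGromovHyperbolic μ hδ
  exact ENNReal.toReal_le_of_le_ofReal hδ.nonneg h
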